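/- Work in space-time $\mathbb R^{1+3}$ with frequencies $(\tau,\xi)$. For $1<r\le 2$, $\frac1r+\frac1{r'}=1$, let $\dot X^r_{s,b}$ be the completion of the Schwartz space $\mathcal S(\mathbb R^{1+3})$ (complex valued) with respect to $$\|u\|_{\dot X^r_{s,b}}=\big\|\,|\xi|^s\langle|\tau|-|\xi|\rangle^b\,\widehat u(\tau,\xi)\big\|_{L^{r'}_{\tau\xi}},\qquad \langle x\rangle=(1+|x|^2)^{1/2}.$$ Let $D=|\nabla|$ be the Fourier multiplier acting as $|\nabla|$ in the space variables, and define null forms by $q_{ij}(Du,Dv)=\partial_iu\,\partial_jv-\partial_ju\,\partial_iv$, $q_{0j}(Du,Dv)=\partial_tu\,\partial_jv-\partial_ju\,\partial_tv$, $q_0(Du,Dv)=\partial_tu\,\partial_tv-\nabla u\cdot\nabla v$ for $1\le i,j\le3$. In $q_{0j}$ and $q_0$ the time derivative is that of the half-waves: $u=u_++u_-$, where $u_\pm$ is the part of $u$ with frequencies in $\pm\tau>0$, and $\partial_tu:=iD(u_+-u_-)$ (the true time derivative on waves $e^{\pm itD}f$). Thus $\partial_jD^{-1}$ has symbol $i\xi_j/|\xi|$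 and $\partial_tD^{-1}$ has symbol $i\,\mathrm{sgn}\,\tau$. Let $1<r\le2$, $b>\frac1r$, $\alpha_0,\alpha_1,\alpha_2\ge0$, $\alpha_1,\alpha_2\le\frac2r$ and $\alpha_1+\alpha_2-\alpha_0=\frac2r$. (1) If $\alpha_1+\alpha_2>\frac3r-1$ and $\alpha_1,\alpha_2\ne\frac2r-\frac12$, then there is a constant $C$ depending only on $r,b,\alpha_0,\alpha_1,\alpha_2$ such that for all $i,j$ $$\|q_{ij}(u,v)\|_{\dot X^r_{\alpha_0,0}}\le C\,\|u\|_{\dot X^r_{\alpha_1,b}}\|v\|_{\dot X^r_{\alpha_2,b}}.$$ (2) Under the assumptions of (1), likewise for all $j$ $$\|q_{0j}(u,v)\|_{\dot X^r_{\alpha_0,0}}\le C\,\|u\|_{\dot X^r_{\alpha_1,b}}\|v\|_{\dot X^r_{\alpha_2,b}}.$$ (3) If $\alpha_1+\alpha_2\ge\frac3r-2$ and $\alpha_1,\alpha_2\ne\frac2r-1$, then, again with $C$ depending only on $r,b,\alpha_0,\alpha_1,\alpha_2$, $$\|q_0(u,v)\|_{\dot X^r_{\alpha_0,0}}\le C\,\|u\|_{\dot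 X^r_{\alpha_1,b}}\|v\|_{\dot X^r_{\alpha_2,b}}.$$ These estimates hold for all $u,v\in\mathcal S(\mathbb R^{1+3})$; there $q(u,v)$ is an integrable function, with Fourier transform $$\widehat{q(u,v)}(p)=\int m(p',p-p')\,\widehat u(p')\,\widehat v(p-p')\,dp'$$ (Fourier transform with kernel $e^{-2\pi i x\cdot p}$), where $m$ is the symbol of $q$, i.e. the same expression in the symbols of $\partial_jD^{-1}$ and $\partial_tD^{-1}$. They also hold for all $u\in\dot X^r_{\alpha_1,b}$, $v\in\dot X^r_{\alpha_2,b}$; there the same integral converges absolutely for almost every $p$ and defines $q(u,v)\in\dot X^r_{\alpha_0,0}$. -/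

import Mathlib

open MeasureTheory
open scoped FourierTransform SchwartzMap ENNReal NNReal

noncomputable section

/-- Space-time `ℝ^{1+3}`: the coordinate `0` is the time `t` (or its dual variable `τ`), the
coordinates `1, 2, 3` are the space variables `x` (or their dual variables `ξ`). -/
abbrev SpaceTime : Type := EuclideanSpace ℝ (Fin 4)

/-- `|ξ|` for a frequency `p = (τ, ξ)`. -/
def spaceNorm (p : SpaceTime) : ℝ := Real.sqrt (∑ j : Fin 3, p j.succ ^ 2)

/-- `⟨x⟩ = (1 + |x|²)^{1/2}`. -/
def japaneseBracket (x : ℝ) : ℝ := Real.sqrt (1 + x ^ 2)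

/-- The weight `|ξ|^s ⟨|τ| - |ξ|⟩^b`. -/
def xWeight (s b : ℝ) (p : SpaceTime) : ℝ :=
  spaceNorm p ^ s * japaneseBracket (|p 0| - spaceNorm p) ^ b

/-- The norm of the homogeneous wave-Sobolev space, as a function of the Fourier transform
`U` of `u`: it is `‖ |ξ|^s ⟨|τ| - |ξ|⟩^b U ‖` in `L^{r'}`, `1/r + 1/r' = 1`.
Other normalizations of the Fourier transform give equivalent norms. -/
def xNorm (r s b : ℝ) (U : SpaceTime → ℂ) : ℝ≥0∞ :=
  eLpNorm (fun p => (xWeight s b p : ℂ) * U p) (ENNReal.ofReal (r / (r - 1))) volume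

/-- `U` is the Fourier transform of an element of the homogeneous wave-Sobolev space. The
completion of the Schwartz space is, by `u ↦ 𝓕 u`, this weighted `L^{r'}` space. -/
def MemX (r s b : ℝ) (U : SpaceTime → ℂ) : Prop :=
  AEStronglyMeasurable U volume ∧ xNorm r s b U < ∞

/-! ### The null forms in physical space -/

/-- `D⁻¹ u`, where `D = |∇|` acts in the space variables; with the kernel `e^{-2πi x·p}` the
symbol of `D` is `2π|ξ|`. -/
def invD (u : SpaceTime → ℂ) : SpaceTime → ℂ :=
  𝓕⁻ (fun p => ((2 * Real.pi * spaceNorm p : ℝ) : ℂ)⁻¹ * 𝓕 u p)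

/-- The space derivative `∂_j f`, `j = 1, 2, 3`. -/
def spaceDeriv (j : Fin 3) (f : SpaceTime → ℂ) (x : SpaceTime) : ℂ :=
  fderiv ℝ f x (EuclideanSpace.single j.succ (1 : ℝ))

/-- The component of `u` with frequencies in `τ > 0`, a superposition of modulated
waves `e^{itD} f`. -/
def plusPart (u : SpaceTime → ℂ) : SpaceTime → ℂ :=
  𝓕⁻ (Set.indicator {p : SpaceTime | 0 < p 0} (𝓕 u))

/-- The component of `u` with frequencies in `τ < 0`, a superposition of modulated
waves `e^{-itD} f`. -/
def minusPart (u : SpaceTime → ℂ) : SpaceTime → ℂ :=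
  𝓕⁻ (Set.indicator {p : SpaceTime | p 0 < 0} (𝓕 u))

/-- `∂_t D⁻¹ u`, the time derivative being that of the half-waves `u = u₊ + u₋`, i.e.
`∂_t u = iD(u₊ - u₋)` (which is the true `∂_t` on waves `e^{±itD} f`). -/
def timeDerivInvD (u : SpaceTime → ℂ) (x : SpaceTime) : ℂ :=
  Complex.I * (plusPart u x - minusPart u x)

/-- `q_{ij}(u, v) = Q_{ij}(D⁻¹u, D⁻¹v)`, with `Q_{ij}(f, g) = ∂_i f ∂_j g - ∂_j f ∂_i g`. -/
def qSpace (i j : Fin 3) (u v : SpaceTime → ℂ) (x : SpaceTime) : ℂ :=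
  spaceDeriv i (invD u) x * spaceDeriv j (invD v) x
    - spaceDeriv j (invD u) x * spaceDeriv i (invD v) x

/-- `q_{0j}(u, v) = Q_{0j}(D⁻¹u, D⁻¹v)`, with `Q_{0j}(f, g) = ∂_t f ∂_j g - ∂_j f ∂_t g`. -/
def qTime (j : Fin 3) (u v : SpaceTime → ℂ) (x : SpaceTime) : ℂ :=
  timeDerivInvD u x * spaceDeriv j (invD v) x
    - spaceDeriv j (invD u) x * timeDerivInvD v x

/-- `q_0(u, v) = Q_0(D⁻¹u, D⁻¹v)`, with `Q_0(f, g) = ∂_t f ∂_t g - ∇f · ∇g`. -/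
def qZero (u v : SpaceTime → ℂ) (x : SpaceTime) : ℂ :=
  timeDerivInvD u x * timeDerivInvD v x
    - ∑ j : Fin 3, spaceDeriv j (invD u) x * spaceDeriv j (invD v) x

/-! ### The null forms on the Fourier side -/

/-- The symbol of `∂_j D⁻¹`. -/
def spaceSymbol (j : Fin 3) (p : SpaceTime) : ℂ :=
  Complex.I * ((p j.succ / spaceNorm p : ℝ) : ℂ)

/-- The symbol `i sgn τ` of `∂_t D⁻¹` for the half-waves; it is the value of `iτ / |ξ|` at
the points `τ = ±|ξ|` of the cone. -/
def timeSymbol (p : SpaceTime) : ℂ := Complex.I * (Real.sign (p 0) : ℂ)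

/-- The symbol of `q_{ij}`. -/
def qSpaceSymbol (i j : Fin 3) (p p' : SpaceTime) : ℂ :=
  spaceSymbol i p * spaceSymbol j p' - spaceSymbol j p * spaceSymbol i p'

/-- The symbol of `q_{0j}`. -/
def qTimeSymbol (j : Fin 3) (p p' : SpaceTime) : ℂ :=
  timeSymbol p * spaceSymbol j p' - spaceSymbol j p * timeSymbol p'

/-- The symbol of `q_0`. -/
def qZeroSymbol (p p' : SpaceTime) : ℂ :=
  timeSymbol p * timeSymbol p' - ∑ j : Fin 3, spaceSymbol j p * spaceSymbol j p'

/-- The Fourier transform of the bilinear form with symbol `m`, applied to functions with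
Fourier transforms `U` and `V`. -/
def bilinearHat (m : SpaceTime → SpaceTime → ℂ) (U V : SpaceTime → ℂ) (p : SpaceTime) : ℂ :=
  ∫ p', m p' (p - p') * U p' * V (p - p')

/-- The estimate
`‖q(u, v)‖_{Ẋ^r_{α₀,0}} ≤ C ‖u‖_{Ẋ^r_{α₁,b}} ‖v‖_{Ẋ^r_{α₂,b}}` for a bilinear form `q` with
symbol `m`: for Schwartz functions, where `q(u, v)` is a pointwise defined integrable function
and its Fourier transform is given by the symbol; and for all elements of the completions,
where `q(u, v)` is given by the symbol, through an integral that converges absolutely almost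
everywhere. -/
structure NullFormEstimate (r b α₀ α₁ α₂ : ℝ) (C : ℝ≥0)
    (q : (SpaceTime → ℂ) → (SpaceTime → ℂ) → SpaceTime → ℂ)
    (m : SpaceTime → SpaceTime → ℂ) : Prop where
  schwartz_integrable : ∀ u v : 𝓢(SpaceTime, ℂ), Integrable (q u v) volume
  schwartz_fourier : ∀ u v : 𝓢(SpaceTime, ℂ),
    𝓕 (q u v) = bilinearHat m (𝓕 (u : SpaceTime → ℂ)) (𝓕 (v : SpaceTime → ℂ))
  schwartz_bound : ∀ u v : 𝓢(SpaceTime, ℂ),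
    xNorm r α₀ 0 (𝓕 (q u v)) ≤
      C * xNorm r α₁ b (𝓕 (u : SpaceTime → ℂ)) * xNorm r α₂ b (𝓕 (v : SpaceTime → ℂ))
  integrable : ∀ U V : SpaceTime → ℂ, MemX r α₁ b U → MemX r α₂ b V →
    ∀ᵐ p : SpaceTime, Integrable (fun p' => m p' (p - p') * U p' * V (p - p')) volume
  mem : ∀ U V : SpaceTime → ℂ, MemX r α₁ b U → MemX r α₂ b V →
    MemX r α₀ 0 (bilinearHat m U V)
  bound : ∀ U V : SpaceTime → ℂ, MemX r α₁ b U → MemX r α₂ b V →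
    xNorm r α₀ 0 (bilinearHat m U V) ≤ C * xNorm r α₁ b U * xNorm r α₂ b V

end

/-!
The three symbols are bounded by a multiple of the same quantity. For frequencies `(τ', η)` and
`(τ - τ', ζ)`, `ζ = ξ - η`, let `θ` be the angle between `η` and `ζ` and `s = sgn τ' sgn (τ - τ')`;
then `|m|² ≤ 4 S` with `S = (1 - s cos θ) / 2`, for each of the null forms (`IsNullSymbol`). Hence one
estimate proves all of them.

By Hölder's inequality with exponents `r`, `r'`, the bilinear estimate follows once
`|ξ|^{α₀ r} ∫ |m|^r W₁^{-r} W₂^{-r} dη dτ'` is bounded uniformly in `(τ, ξ)`, where `W₁`, `W₂` are the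
weights of the two norms (`lintegral_bilinear_le`, `xNorm_bilinearHat_le`). The weights contain the
factors `⟨|τ'| - |η|⟩^{-br}` and `⟨|τ - τ'| - |ζ|⟩^{-br}`, integrable in one variable as `br > 1`.
With the signs of `τ'` and `τ - τ'` fixed, the integral over `τ'` is a function of `±|η| ± |ζ|` alone
(`lintegral_interaction_le`). So everything is reduced to a statement about free waves: under the
measure `S^{r/2} |η|^{-α₁ r} |ζ|^{-α₂ r} dη` the function `±|η| ± |ζ|` has a density bounded by a
multiple of `|ξ|^{-α₀ r}` (`lintegral_angleDefect_comp_le`).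

That density is computed in bipolar coordinates `ρ = |η|`, `σ = |ζ|`, in which
`dη = (2π / |ξ|) ρ σ dρ dσ` on the set of triangles with sides `ρ`, `σ`, `d = |ξ|`
(`lintegral_bipolar_le`). Let `σ ≤ ρ` and `v = ρ + s σ`. If `σ ≤ d`, then `ρ` is comparable to `d` and
`S ≤ |v - d| / σ`; only `S^{1/2}` is used, and the integral of `|v - d|^{1/2} σ^{-3/2}` over
`σ ≥ |v - d| / 2` does not depend on `v`. If `σ ≥ d`, then `ρ` is comparable to `σ`; for `s = 1` the
variable `σ` is confined to an interval of length `d`, and for `s = -1` the bound `S ≤ (d / σ)²` gives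
the integrable decay `σ^{-r}` (`density_le`, `lintegral_densityMajorant_le`).

For Schwartz functions `∂_j D⁻¹ u` and `∂_t D⁻¹ u` are the inverse Fourier transforms of `û` times the
symbols, and the Fourier transform of a product of two such functions is the convolution, by Parseval's
identity on `L¹ ∩ L²` (`fourier_fourierInv_mul`).
-/

/-! ### Parseval's identity for integrable, square integrable functions -/

section Parseval

variable {V : Type*} [NormedAddCommGroup V] [InnerProductSpace ℝ V] [FiniteDimensional ℝ V]
  [MeasurableSpace V] [BorelSpace V]

/-- On `L¹ ∩ L²` the Fourier integral agrees with the `L²` Fourier transform: both are the Fourier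
transform as a tempered distribution. -/
theorem fourier_ae_eq_Lp_fourier {f : V → ℂ} (h1 : Integrable f) (h2 : MemLp f 2) :
    𝓕 f =ᵐ[volume] (𝓕 (h2.toLp f) : Lp ℂ 2 (volume : Measure V)) := by
  have hcont : Continuous (𝓕 f) :=
    VectorFourier.fourierIntegral_continuous Real.continuous_fourierChar
      (by exact continuous_inner) h1
  have hloc2 : LocallyIntegrable (𝓕 (h2.toLp f) : Lp ℂ 2 (volume : Measure V)) volume :=
    (Lp.memLp _).locallyIntegrable (by norm_num)
  have key : ∀ᵐ x, 𝓕 f x - (𝓕 (h2.toLp f) : Lp ℂ 2 (volume : Measure V)) x = 0 := by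
    apply ae_eq_zero_of_integral_contDiff_smul_eq_zero
      (hcont.locallyIntegrable.sub hloc2)
    intro φ hφ hφc
    set φ' : V → ℂ := fun x => (φ x : ℂ) with hφ'
    have hc : HasCompactSupport φ' := hφc.comp_left (g := fun t : ℝ => (t : ℂ)) (by simp)
    have hs : ContDiff ℝ ((⊤ : ℕ∞) : WithTop ℕ∞) φ' := Complex.ofRealCLM.contDiff.comp hφ
    set ψ : 𝓢(V, ℂ) := hc.toSchwartzMap hs with hψ
    have hψe : ∀ x, ψ x = (φ x : ℂ) := fun x => rfl
    have e1 : ∫ x, ψ x • 𝓕 f x = ∫ x, 𝓕 (ψ : V → ℂ) x • f x := by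
      have := VectorFourier.integral_fourierIntegral_smul_eq_flip (L := innerₗ V) (μ := volume)
        (ν := volume) (f := (ψ : V → ℂ)) (g := f) Real.continuous_fourierChar
        continuous_inner ψ.integrable h1
      rw [flip_innerₗ] at this
      exact this.symm
    have e2 : ∫ x, ψ x • (𝓕 (h2.toLp f) : Lp ℂ 2 (volume : Measure V)) x
        = ∫ x, 𝓕 (ψ : V → ℂ) x • f x := by
      have := congrArg (fun T => T ψ) (Lp.fourier_toTemperedDistribution_eq (h2.toLp f))
      simp only [TemperedDistribution.fourier_apply, Lp.toTemperedDistribution_apply] at this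
      rw [← this]
      apply integral_congr_ae
      filter_upwards [h2.coeFn_toLp] with x hx
      rw [hx, SchwartzMap.fourier_coe]
    have i1 : Integrable (fun x => ψ x • 𝓕 f x) :=
      (hcont.locallyIntegrable.integrable_smul_left_of_hasCompactSupport ψ.continuous hc)
    have i2 : Integrable (fun x => ψ x • (𝓕 (h2.toLp f) : Lp ℂ 2 (volume : Measure V)) x) :=
      (hloc2.integrable_smul_left_of_hasCompactSupport ψ.continuous hc)
    have : ∀ x, φ x • (𝓕 f x - (𝓕 (h2.toLp f) : Lp ℂ 2 (volume : Measure V)) x)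
        = ψ x • 𝓕 f x - ψ x • (𝓕 (h2.toLp f) : Lp ℂ 2 (volume : Measure V)) x := by
      intro x
      rw [hψe, ← smul_sub, Complex.coe_smul]
    refine (integral_congr_ae (Filter.Eventually.of_forall this)).trans ?_
    rw [integral_sub i1 i2, e1, e2, sub_self]
  filter_upwards [key] with x hx
  exact sub_eq_zero.mp hx

theorem memLp_two_fourier {f : V → ℂ} (h1 : Integrable f) (h2 : MemLp f 2) :
    MemLp (𝓕 f) 2 :=
  (memLp_congr_ae (fourier_ae_eq_Lp_fourier h1 h2)).mpr (Lp.memLp _)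

theorem integral_conj_fourier_mul_fourier {f g : V → ℂ} (hf1 : Integrable f) (hf2 : MemLp f 2)
    (hg1 : Integrable g) (hg2 : MemLp g 2) :
    ∫ x, starRingEnd ℂ (𝓕 f x) * 𝓕 g x = ∫ x, starRingEnd ℂ (f x) * g x := by
  have := Lp.inner_fourier_eq (hf2.toLp f) (hg2.toLp g)
  rw [L2.inner_def, L2.inner_def] at this
  calc _ = ∫ x, inner ℂ ((𝓕 (hf2.toLp f) : Lp ℂ 2 (volume : Measure V)) x)
        ((𝓕 (hg2.toLp g) : Lp ℂ 2 (volume : Measure V)) x) := by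
        apply integral_congr_ae
        filter_upwards [fourier_ae_eq_Lp_fourier hf1 hf2, fourier_ae_eq_Lp_fourier hg1 hg2]
          with x h h'
        rw [h, h', RCLike.inner_apply, mul_comm]
    _ = _ := this
    _ = _ := by
        apply integral_congr_ae
        filter_upwards [hf2.coeFn_toLp, hg2.coeFn_toLp] with x h h'
        rw [h, h', RCLike.inner_apply, mul_comm]

theorem memLp_two_fourierInv {f : V → ℂ} (h1 : Integrable f) (h2 : MemLp f 2) :
    MemLp (𝓕⁻ f) 2 := by
  have : 𝓕⁻ f = (𝓕 f) ∘ (fun x => -x) := by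
    ext x; rw [Real.fourierInv_eq_fourier_neg]; rfl
  rw [this]
  exact (memLp_two_fourier h1 h2).comp_measurePreserving (Measure.measurePreserving_neg _)

theorem integrable_fourierInv_mul {f g : V → ℂ} (hf1 : Integrable f) (hf2 : MemLp f 2)
    (hg1 : Integrable g) (hg2 : MemLp g 2) :
    Integrable (fun x => 𝓕⁻ f x * 𝓕⁻ g x) :=
  (memLp_two_fourierInv hf1 hf2).integrable_mul (memLp_two_fourierInv hg1 hg2)

theorem integrable_mul_comp_sub {f g : V → ℂ} (hf2 : MemLp f 2) (hg2 : MemLp g 2) (p : V) :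
    Integrable (fun p' => f p' * g (p - p')) :=
  hf2.integrable_mul (hg2.comp_measurePreserving (Measure.measurePreserving_sub_left volume p))

/-- The Fourier transform turns the product of `𝓕⁻ f` and `𝓕⁻ g` into the convolution of `f` and
`g`. The identity holds at every point, being Parseval's identity for `f` and the reflected
translate of the conjugate of `g`. -/
theorem fourier_fourierInv_mul {f g : V → ℂ} (hf1 : Integrable f) (hf2 : MemLp f 2)
    (hg1 : Integrable g) (hg2 : MemLp g 2) (p : V) :
    𝓕 (fun x => 𝓕⁻ f x * 𝓕⁻ g x) p = ∫ p', f p' * g (p - p') := by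
  set h : V → ℂ := fun p' => starRingEnd ℂ (g (p - p')) with hh
  have hmp := Measure.measurePreserving_sub_left (volume : Measure V) p
  have hh1 : Integrable h := by
    have := (hmp.integrable_comp_of_integrable hg1)
    exact (RCLike.conjLIE.toContinuousLinearEquiv.toContinuousLinearMap.integrable_comp this)
  have hh2 : MemLp h 2 := by
    have := hg2.comp_measurePreserving hmp
    exact this.star
  have hF : ∀ x, starRingEnd ℂ (𝓕 h (-x)) = Real.fourierChar (-inner ℝ x p) • 𝓕⁻ g x := by
    intro x
    rw [← Real.fourierInv_eq_fourier_neg, Real.fourierInv_eq, Real.fourierInv_eq, ← integral_conj,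
      Circle.smul_def, smul_eq_mul, ← integral_const_mul,
      ← integral_sub_left_eq_self (fun v => _ * _) volume p]
    apply integral_congr_ae
    filter_upwards with y
    simp only [hh, Circle.smul_def, smul_eq_mul, map_mul, Complex.conj_conj]
    rw [← mul_assoc, ← Circle.coe_mul, ← AddChar.map_add_eq_mul, ← Circle.coe_inv_eq_conj,
      ← AddChar.map_neg_eq_inv, inner_sub_left, real_inner_comm p x]
    ring_nf
  calc _ = ∫ x, starRingEnd ℂ (𝓕 h (-x)) * 𝓕 f (-x) := by
        rw [Real.fourier_eq]
        apply integral_congr_ae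
        filter_upwards with x
        rw [hF, ← Real.fourierInv_eq_fourier_neg, Circle.smul_def, Circle.smul_def]
        simp only [smul_eq_mul]; ring
    _ = ∫ x, starRingEnd ℂ (𝓕 h x) * 𝓕 f x :=
        integral_neg_eq_self (fun x => starRingEnd ℂ (𝓕 h x) * 𝓕 f x) volume
    _ = _ := by
        rw [integral_conj_fourier_mul_fourier hh1 hh2 hf1 hf2]
        apply integral_congr_ae
        filter_upwards with x
        simp only [hh, Complex.conj_conj]; ring

end Parseval

/-! ### Bipolar coordinates in `ℝ³` -/

/-- The substitution `P = ρ²`. -/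
theorem lintegral_Ioi_eq_lintegral_sq (G : ℝ → ℝ≥0∞) :
    ∫⁻ P in Set.Ioi (0 : ℝ), G P
      = ∫⁻ ρ in Set.Ioi (0 : ℝ), ENNReal.ofReal (2 * ρ) * G (ρ ^ 2) := by
  have himg : (fun ρ : ℝ => ρ ^ 2) '' Set.Ioi 0 = Set.Ioi 0 := by
    ext x
    constructor
    · rintro ⟨y, hy, rfl⟩
      exact pow_pos (Set.mem_Ioi.mp hy) 2
    · intro hx
      exact ⟨Real.sqrt x, Real.sqrt_pos.mpr hx, Real.sq_sqrt (le_of_lt hx)⟩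
  have := lintegral_image_eq_lintegral_abs_deriv_mul (s := Set.Ioi (0 : ℝ))
    (f := fun ρ => ρ ^ 2) (f' := fun ρ => 2 * ρ) measurableSet_Ioi
    (fun x _ => by simpa using (hasDerivAt_pow 2 x).hasDerivWithinAt)
    (fun x hx y hy h => by
      exact (sq_eq_sq₀ (le_of_lt hx) (le_of_lt hy)).mp h) G
  rw [himg] at this
  rw [this]
  refine setLIntegral_congr_fun measurableSet_Ioi fun x hx => ?_
  rw [abs_of_pos (mul_pos two_pos (Set.mem_Ioi.mp hx))]

/-- Polar coordinates in the plane, in terms of the square of the radius. -/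
theorem lintegral_comp_sq_add_sq (G : ℝ → ℝ≥0∞) (hG : Measurable G) :
    ∫⁻ z : ℝ × ℝ, G (z.1 ^ 2 + z.2 ^ 2)
      = ENNReal.ofReal Real.pi * ∫⁻ s in Set.Ioi (0 : ℝ), G s := by
  rw [← lintegral_comp_polarCoord_symm, lintegral_Ioi_eq_lintegral_sq]
  have h1 : ∀ p : ℝ × ℝ, ENNReal.ofReal p.1 • G ((polarCoord.symm p).1 ^ 2
      + (polarCoord.symm p).2 ^ 2) = ENNReal.ofReal p.1 * G (p.1 ^ 2) := by
    intro p
    rw [smul_eq_mul, polarCoord_symm_apply]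
    congr 2
    simp only
    linear_combination p.1 ^ 2 * Real.sin_sq_add_cos_sq p.2
  simp_rw [h1]
  rw [polarCoord_target, Measure.volume_eq_prod, setLIntegral_prod _ (by fun_prop)]
  simp only [lintegral_const, Measure.restrict_apply_univ, Real.volume_Ioo]
  rw [lintegral_mul_const _ (by fun_prop), ← lintegral_const_mul _ (by fun_prop),
    ← lintegral_mul_const _ (by fun_prop)]
  refine setLIntegral_congr_fun measurableSet_Ioi fun x hx => ?_
  rw [show Real.pi - -Real.pi = 2 * Real.pi by ring, ENNReal.ofReal_mul two_pos.le,
    ENNReal.ofReal_mul two_pos.le]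
  ring

/-- Integration over `ℝ³` in terms of the coordinates on `ℝ × ℝ²`. -/
theorem lintegral_euclidean_three (G : ℝ → ℝ × ℝ → ℝ≥0∞) (hG : Measurable (Function.uncurry G)) :
    ∫⁻ η : EuclideanSpace ℝ (Fin 3), G (η 0) (η 1, η 2)
      = ∫⁻ x : ℝ, ∫⁻ z : ℝ × ℝ, G x z := by
  have e1 := (EuclideanSpace.volume_preserving_symm_measurableEquiv_toLp (Fin 3))
  have e2 := volume_preserving_piFinSuccAbove (fun _ : Fin 3 => ℝ) 0
  have e3 := (MeasurePreserving.id (volume : Measure ℝ)).prod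
    (volume_preserving_piFinTwo (fun _ : Fin 2 => ℝ))
  have e := e3.comp (e2.comp e1)
  have := e.lintegral_comp hG
  rw [← Measure.volume_eq_prod, Measure.volume_eq_prod, lintegral_prod _ (by fun_prop)] at this
  exact this

/-- The triangle inequalities for a triangle with sides `ρ`, `σ`, `d`. -/
def IsTriangle (d ρ σ : ℝ) : Prop := |ρ - σ| ≤ d ∧ d ≤ ρ + σ

theorem measurableSet_isTriangle (d : ℝ) : MeasurableSet {z : ℝ × ℝ | IsTriangle d z.1 z.2} := by
  have h1 : MeasurableSet {z : ℝ × ℝ | |z.1 - z.2| ≤ d} :=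
    measurableSet_le (by fun_prop) measurable_const
  have h2 : MeasurableSet {z : ℝ × ℝ | d ≤ z.1 + z.2} :=
    measurableSet_le measurable_const (by fun_prop)
  exact h1.inter h2

theorem exists_linearIsometryEquiv_single (ξ : EuclideanSpace ℝ (Fin 3)) :
    ∃ T : EuclideanSpace ℝ (Fin 3) ≃ₗᵢ[ℝ] EuclideanSpace ℝ (Fin 3),
      T ξ = EuclideanSpace.single 0 ‖ξ‖ := by
  refine ⟨_, Submodule.reflection_sub (v := ξ) (w := EuclideanSpace.single 0 ‖ξ‖) ?_⟩
  simp

theorem sqrt_sub_single (d : ℝ) (η : EuclideanSpace ℝ (Fin 3)) :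
    ‖EuclideanSpace.single 0 d - η‖ = Real.sqrt ((d - η 0) ^ 2 + (η 1 ^ 2 + η 2 ^ 2)) := by
  rw [EuclideanSpace.norm_eq, Fin.sum_univ_three]
  simp [add_assoc]

theorem lintegral_comp_affine (G : ℝ → ℝ≥0∞) (c : ℝ) {d : ℝ} (hd : 0 < d) :
    ∫⁻ x, G x = ENNReal.ofReal (1 / (2 * d)) * ∫⁻ Q, G ((c - Q) / (2 * d)) := by
  have hd2 : (2 * d) ≠ 0 := by positivity
  have himg : (fun Q : ℝ => (c - Q) / (2 * d)) '' Set.univ = Set.univ := by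
    refine Set.image_univ_of_surjective fun x => ⟨c - 2 * d * x, ?_⟩
    field_simp
    ring
  have := lintegral_image_eq_lintegral_abs_deriv_mul (s := Set.univ)
    (f := fun Q => (c - Q) / (2 * d)) (f' := fun _ => (-1) / (2 * d)) MeasurableSet.univ
    (fun x _ => (((hasDerivAt_id x).const_sub c).div_const (2 * d)).hasDerivWithinAt)
    (fun x _ y _ h => by
      simp only at h
      field_simp at h
      linarith) G
  rw [himg, setLIntegral_univ, setLIntegral_univ] at this
  rw [this, lintegral_const_mul' _ _ ENNReal.ofReal_ne_top]
  congr 2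
  rw [abs_div, abs_of_pos (by positivity : 0 < 2 * d)]
  simp

/-- A point at distances `√P` from `0` and `√Q` from `ξ`, `|ξ| = d`, has the component
`(P + d² - Q) / (2d)` along `ξ`. If this is less than `√P` in absolute value, then `√P`, `√Q`, `d` are
the sides of a triangle. -/
theorem isTriangle_of_sq_lt {d P Q : ℝ} (hd : 0 < d)
    (h : ((P + d ^ 2 - Q) / (2 * d)) ^ 2 < P) :
    0 < P ∧ 0 < Q ∧ IsTriangle d (Real.sqrt P) (Real.sqrt Q) := by
  have hP : 0 < P := lt_of_le_of_lt (sq_nonneg _) h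
  have hQ : 0 < Q := by
    have e : Q = P - 2 * d * ((P + d ^ 2 - Q) / (2 * d)) + d ^ 2 := by field_simp; ring
    nlinarith [sq_nonneg ((P + d ^ 2 - Q) / (2 * d) - d)]
  obtain ⟨ρ, hρ, rfl⟩ : ∃ ρ, 0 < ρ ∧ ρ ^ 2 = P := ⟨_, Real.sqrt_pos.mpr hP, Real.sq_sqrt hP.le⟩
  obtain ⟨σ, hσ, rfl⟩ : ∃ σ, 0 < σ ∧ σ ^ 2 = Q := ⟨_, Real.sqrt_pos.mpr hQ, Real.sq_sqrt hQ.le⟩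
  refine ⟨hP, hQ, ?_⟩
  rw [Real.sqrt_sq hρ.le, Real.sqrt_sq hσ.le]
  rw [div_pow, div_lt_iff₀ (by positivity)] at h
  have h' := abs_lt_of_sq_lt_sq (a := ρ ^ 2 + d ^ 2 - σ ^ 2) (b := 2 * d * ρ)
    (by nlinarith) (by positivity)
  rw [abs_lt] at h'
  have h1 : |ρ - d| < σ := abs_lt_of_sq_lt_sq (by nlinarith) hσ.le
  have h2 : |σ| < ρ + d := by
    apply abs_lt_of_sq_lt_sq (by nlinarith) (by positivity)
  rw [abs_lt] at h1 h2
  exact ⟨abs_le.mpr ⟨by linarith, by linarith⟩, by linarith⟩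

/-- Bipolar coordinates: in `ℝ³` the distances `ρ`, `σ` to the points `0`, `ξ` have the joint
density `(2π / |ξ|) ρ σ` on the set of triangles. -/
theorem lintegral_bipolar_le (F : ℝ → ℝ → ℝ≥0∞) (hF : Measurable (Function.uncurry F))
    {ξ : EuclideanSpace ℝ (Fin 3)} (hξ : ξ ≠ 0) :
    ∫⁻ η, F ‖η‖ ‖ξ - η‖ ≤ ENNReal.ofReal (2 * Real.pi / ‖ξ‖) *
      ∫⁻ ρ in Set.Ioi (0 : ℝ), ∫⁻ σ in Set.Ioi (0 : ℝ),
        {z : ℝ × ℝ | IsTriangle ‖ξ‖ z.1 z.2}.indicator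
          (fun z => ENNReal.ofReal (z.1 * z.2) * F z.1 z.2) (ρ, σ) := by
  have hd : 0 < ‖ξ‖ := norm_pos_iff.mpr hξ
  obtain ⟨T, hT⟩ := exists_linearIsometryEquiv_single ξ
  generalize hdd : ‖ξ‖ = d at *
  set Φ : ℝ × ℝ → ℝ≥0∞ := {z : ℝ × ℝ | IsTriangle d z.1 z.2}.indicator (Function.uncurry F)
    with hΦ
  have hΦm : Measurable Φ := hF.indicator (measurableSet_isTriangle d)
  set Ψ : ℝ × ℝ → ℝ≥0∞ := {z : ℝ × ℝ | z.1 ^ 2 < z.2}.indicator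
    (fun z => F (Real.sqrt z.2) (Real.sqrt (z.2 - 2 * d * z.1 + d ^ 2))) with hΨ
  have hΨm : Measurable Ψ := by
    refine Measurable.indicator ?_ (measurableSet_lt (by fun_prop) (by fun_prop))
    exact hF.comp (f := fun z : ℝ × ℝ => (Real.sqrt z.2, Real.sqrt (z.2 - 2 * d * z.1 + d ^ 2)))
      (by fun_prop)
  have hcyl : ∀ x : ℝ, Measurable fun s : ℝ =>
      F (Real.sqrt (x ^ 2 + s)) (Real.sqrt ((d - x) ^ 2 + s)) := fun x =>
    hF.comp (f := fun s : ℝ => (Real.sqrt (x ^ 2 + s), Real.sqrt ((d - x) ^ 2 + s)))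
      (by fun_prop)
  -- Cylindrical coordinates `(x, s)` with `x` along `ξ` and `s` the squared distance from the axis;
  -- then `P = x² + s = |η|²` for fixed `x`, and `Q = P - 2dx + d² = |ξ - η|²` for fixed `P`.
  calc ∫⁻ η, F ‖η‖ ‖ξ - η‖
      = ∫⁻ η, F ‖η‖ ‖EuclideanSpace.single (0 : Fin 3) d - η‖ := by
        rw [← T.measurePreserving.lintegral_comp_emb T.toHomeomorph.measurableEmbedding
          (fun η => F ‖η‖ ‖EuclideanSpace.single (0 : Fin 3) d - η‖)]
        refine lintegral_congr fun η => ?_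
        rw [← hT, ← map_sub, T.norm_map, T.norm_map]
    _ = ∫⁻ x : ℝ, ∫⁻ z : ℝ × ℝ, F (Real.sqrt (x ^ 2 + (z.1 ^ 2 + z.2 ^ 2)))
          (Real.sqrt ((d - x) ^ 2 + (z.1 ^ 2 + z.2 ^ 2))) := by
        rw [← lintegral_euclidean_three (fun x z => F (Real.sqrt (x ^ 2 + (z.1 ^ 2 + z.2 ^ 2)))
          (Real.sqrt ((d - x) ^ 2 + (z.1 ^ 2 + z.2 ^ 2))))
          (hF.comp (f := fun w : ℝ × (ℝ × ℝ) =>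
            (Real.sqrt (w.1 ^ 2 + (w.2.1 ^ 2 + w.2.2 ^ 2)),
              Real.sqrt ((d - w.1) ^ 2 + (w.2.1 ^ 2 + w.2.2 ^ 2)))) (by fun_prop))]
        refine lintegral_congr fun η => ?_
        rw [sqrt_sub_single, EuclideanSpace.norm_eq, Fin.sum_univ_three]
        simp [add_assoc]
    _ = ∫⁻ x : ℝ, ENNReal.ofReal Real.pi * ∫⁻ P, Ψ (x, P) := by
        refine lintegral_congr fun x => ?_
        rw [lintegral_comp_sq_add_sq _ (hcyl x)]
        congr 1
        rw [← lintegral_indicator measurableSet_Ioi,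
          ← lintegral_sub_right_eq_self _ (x ^ 2)]
        refine lintegral_congr fun P => ?_
        simp only [hΨ, Set.indicator_apply, Set.mem_Ioi, Set.mem_ofPred_eq, sub_pos]
        refine if_congr Iff.rfl ?_ rfl
        congr 2 <;> ring
    _ = ENNReal.ofReal Real.pi * ∫⁻ P, ∫⁻ x, Ψ (x, P) := by
        rw [lintegral_const_mul' _ _ ENNReal.ofReal_ne_top,
          lintegral_lintegral_swap (f := fun x P => Ψ (x, P)) hΨm.aemeasurable]
    _ = ENNReal.ofReal Real.pi * (ENNReal.ofReal (1 / (2 * d)) *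
          ∫⁻ P, ∫⁻ Q, Ψ ((P + d ^ 2 - Q) / (2 * d), P)) := by
        congr 1
        rw [← lintegral_const_mul' _ _ ENNReal.ofReal_ne_top]
        exact lintegral_congr fun P => lintegral_comp_affine (fun x => Ψ (x, P)) (P + d ^ 2) hd
    _ ≤ ENNReal.ofReal Real.pi * (ENNReal.ofReal (1 / (2 * d)) *
          ∫⁻ P in Set.Ioi (0 : ℝ), ∫⁻ Q in Set.Ioi (0 : ℝ), Φ (Real.sqrt P, Real.sqrt Q)) := by
        refine mul_le_mul_right (mul_le_mul_right ?_ _) _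
        rw [← lintegral_indicator measurableSet_Ioi]
        refine lintegral_mono fun P => ?_
        by_cases hP : 0 < P
        · rw [Set.indicator_of_mem (Set.mem_Ioi.mpr hP), ← lintegral_indicator measurableSet_Ioi]
          refine lintegral_mono fun Q => ?_
          simp only [hΨ]
          by_cases h : ((P + d ^ 2 - Q) / (2 * d)) ^ 2 < P
          swap
          · rw [Set.indicator_of_notMem (by simpa using h)]
            exact zero_le
          obtain ⟨-, hQ, ht⟩ := isTriangle_of_sq_lt hd h
          rw [Set.indicator_of_mem (by simpa using h), Set.indicator_of_mem (Set.mem_Ioi.mpr hQ),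
            hΦ, Set.indicator_of_mem (by simpa using ht)]
          simp only [Function.uncurry]
          apply le_of_eq
          congr 2
          field_simp
          ring
        · refine le_of_eq_of_le ?_ zero_le
          rw [lintegral_eq_zero_iff (by fun_prop)]
          filter_upwards with Q
          refine Set.indicator_of_notMem (fun h => hP (isTriangle_of_sq_lt (Q := Q) hd ?_).1) _
          simpa using h
    _ = ENNReal.ofReal Real.pi * (ENNReal.ofReal (1 / (2 * d)) *
          ∫⁻ ρ in Set.Ioi (0 : ℝ), ∫⁻ σ in Set.Ioi (0 : ℝ),
            4 * {z : ℝ × ℝ | IsTriangle d z.1 z.2}.indicator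
          (fun z => ENNReal.ofReal (z.1 * z.2) * F z.1 z.2) (ρ, σ)) := by
        rw [lintegral_Ioi_eq_lintegral_sq]
        congr 2
        refine setLIntegral_congr_fun measurableSet_Ioi fun ρ hρ => ?_
        rw [lintegral_Ioi_eq_lintegral_sq, ← lintegral_const_mul' _ _ ENNReal.ofReal_ne_top]
        refine setLIntegral_congr_fun measurableSet_Ioi fun σ hσ => ?_
        have hρ' : 0 < ρ := hρ
        have hσ' : 0 < σ := hσ
        rw [Real.sqrt_sq hρ'.le, Real.sqrt_sq hσ'.le, hΦ]
        by_cases h : IsTriangle d ρ σ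
        · rw [Set.indicator_of_mem (by simpa using h), Set.indicator_of_mem (by simpa using h),
            ENNReal.ofReal_mul two_pos.le, ENNReal.ofReal_mul two_pos.le,
            ENNReal.ofReal_mul hρ'.le, ENNReal.ofReal_ofNat]
          simp only [Function.uncurry]
          ring
        · rw [Set.indicator_of_notMem (by simpa using h),
            Set.indicator_of_notMem (by simpa using h)]
          simp
    _ = _ := by
        simp_rw [lintegral_const_mul' (4 : ℝ≥0∞) _ (by norm_num)]
        rw [← mul_assoc, ← mul_assoc, ← ENNReal.ofReal_mul Real.pi_pos.le,
          ← ENNReal.ofReal_ofNat 4, ← ENNReal.ofReal_mul (by positivity)]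
        congr 2
        field_simp
        norm_num

/-! ### The density of `|η| ± |ξ - η|` -/

/-- For a triangle with sides `ρ = |η|`, `σ = |ζ|`, `d = |η + ζ|` and a sign `s = ±1`, this is
`(1 - s cos θ) / 2`, where `θ` is the angle between `η` and `ζ`. -/
noncomputable def angleDefect (s d ρ σ : ℝ) : ℝ := s * ((ρ + s * σ) ^ 2 - d ^ 2) / (4 * ρ * σ)

theorem measurable_angleDefect (s d : ℝ) :
    Measurable fun z : ℝ × ℝ => angleDefect s d z.1 z.2 := by
  unfold angleDefect
  fun_prop

theorem angleDefect_swap {s d ρ σ : ℝ} (hs : s = 1 ∨ s = -1) :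
    angleDefect s d ρ σ = angleDefect s d σ ρ := by
  unfold angleDefect
  rcases hs with rfl | rfl <;> ring

theorem IsTriangle.swap {d ρ σ : ℝ} (h : IsTriangle d ρ σ) : IsTriangle d σ ρ :=
  ⟨by rw [abs_sub_comm]; exact h.1, by rw [add_comm]; exact h.2⟩

theorem angleDefect_nonneg {s d ρ σ : ℝ} (hs : s = 1 ∨ s = -1) (hd : 0 < d) (hρ : 0 < ρ)
    (hσ : 0 < σ) (h : IsTriangle d ρ σ) : 0 ≤ angleDefect s d ρ σ := by
  obtain ⟨h1, h2⟩ := h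
  rw [abs_le] at h1
  unfold angleDefect
  apply div_nonneg _ (by positivity)
  rcases hs with rfl | rfl <;> nlinarith

theorem angleDefect_le_one {s d ρ σ : ℝ} (hs : s = 1 ∨ s = -1) (hρ : 0 < ρ)
    (hσ : 0 < σ) (h : IsTriangle d ρ σ) : angleDefect s d ρ σ ≤ 1 := by
  obtain ⟨h1, h2⟩ := h
  rw [abs_le] at h1
  unfold angleDefect
  rw [div_le_one (by positivity)]
  rcases hs with rfl | rfl <;> nlinarith

/-- The factor `s (v - d)` vanishes at the value `v = d` where the level sets of `|η| + s |ζ|`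
degenerate to a segment or a ray. -/
theorem angleDefect_le {s d ρ σ : ℝ} (hs : s = 1 ∨ s = -1) (hρ : 0 < ρ)
    (hσ : 0 < σ) (h : IsTriangle d ρ σ) (hσρ : σ ≤ ρ) :
    angleDefect s d ρ σ ≤ s * (ρ + s * σ - d) / σ := by
  obtain ⟨h1, h2⟩ := h
  rw [abs_le] at h1
  unfold angleDefect
  rw [div_le_div_iff₀ (by positivity) hσ]
  rcases hs with rfl | rfl
  · have : 0 ≤ (ρ + σ - d) * (4 * ρ - (ρ + σ + d)) * σ :=
      mul_nonneg (mul_nonneg (by linarith) (by linarith)) hσ.le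
    nlinarith
  · have : 0 ≤ (d - (ρ - σ)) * (4 * ρ - (ρ - σ + d)) * σ :=
      mul_nonneg (mul_nonneg (by linarith) (by linarith)) hσ.le
    nlinarith

theorem rpow_le_two_mul_rpow {x y c : ℝ} (hx : 0 < x) (hy : 0 < y) (h1 : y ≤ 2 * x)
    (h2 : x ≤ 2 * y) (hc1 : -1 ≤ c) (hc2 : c ≤ 1) : x ^ c ≤ 2 * y ^ c := by
  have h2c : ∀ t : ℝ, t ≤ 1 → (2 : ℝ) ^ t ≤ 2 := fun t ht => by
    simpa using Real.rpow_le_rpow_of_exponent_le (by norm_num : (1 : ℝ) ≤ 2) ht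
  rcases le_total 0 c with hc | hc
  · calc x ^ c ≤ (2 * y) ^ c := Real.rpow_le_rpow hx.le h2 hc
      _ = 2 ^ c * y ^ c := Real.mul_rpow two_pos.le hy.le
      _ ≤ 2 * y ^ c := by gcongr; exact h2c c hc2
  · calc x ^ c ≤ (y / 2) ^ c := Real.rpow_le_rpow_of_nonpos (by positivity) (by linarith) hc
      _ = 2 ^ (-c) * y ^ c := by
        rw [Real.div_rpow hy.le two_pos.le, Real.rpow_neg two_pos.le]; field_simp
      _ ≤ 2 * y ^ c := by gcongr; exact h2c (-c) (by linarith)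

/-- A majorant, up to the factor `d ^ (1 - γ)`, of the density in bipolar coordinates at
`v = ρ + s σ`, in the part `σ ≤ ρ`. Its integral over `σ` is bounded uniformly in `v`. -/
noncomputable def densityMajorant (r s d v σ : ℝ) : ℝ≥0∞ :=
  (Set.Ici (s * (v - d) / 2)).indicator
      (fun σ => ENNReal.ofReal (2 * (Real.sqrt (s * (v - d)) * σ ^ (-(3 / 2) : ℝ)))) σ
    + (Set.Icc ((v - d) / 2) ((v + d) / 2)).indicator (fun _ => ENNReal.ofReal (2 / d)) σ
    + (Set.Ioi d).indicator (fun σ => ENNReal.ofReal (2 * d ^ (r - 1) * σ ^ (-r))) σ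

/-- The density of the weight in bipolar coordinates, in the part `σ ≤ ρ`. The first and the last
term of the majorant account for `σ ≤ d` and for `σ > d`, `s = -1`; the middle one for `σ > d`,
`s = 1`. -/
theorem density_le {r s d ρ σ A B γ : ℝ} (hr : 1 < r) (hs : s = 1 ∨ s = -1) (hd : 0 < d)
    (hρ : 0 < ρ) (hσ : 0 < σ) (h : IsTriangle d ρ σ) (hσρ : σ ≤ ρ)
    (hA : 0 ≤ A) (hA' : A ≤ 2) (hB' : B ≤ 2) (hγ : 0 ≤ γ) (hAB : A + B = 2 + γ) :
    ENNReal.ofReal (angleDefect s d ρ σ ^ (r / 2) * ρ ^ (1 - A) * σ ^ (1 - B))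
      ≤ ENNReal.ofReal (d ^ (1 - γ)) * densityMajorant r s d (ρ + s * σ) σ := by
  have S0 := angleDefect_nonneg hs hd hρ hσ h
  have S1 := angleDefect_le_one hs hρ hσ h
  have Sle := angleDefect_le hs hρ hσ h hσρ
  set S := angleDefect s d ρ σ with hS
  have h1 := abs_le.mp h.1
  have h2 := h.2
  rcases le_or_gt σ d with hσd | hσd
  · set e := s * (ρ + s * σ - d) with he
    have he0 : 0 ≤ e := by rcases hs with rfl | rfl <;> linarith
    have he2 : e / 2 ≤ σ := by rcases hs with rfl | rfl <;> linarith
    have b1 : S ^ (r / 2) ≤ Real.sqrt e * σ ^ (-(1 / 2) : ℝ) := by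
      calc S ^ (r / 2) ≤ S ^ (1 / 2 : ℝ) :=
            Real.rpow_le_rpow_of_exponent_ge_of_imp S0 S1 (by linarith)
              (fun _ h => by linarith)
        _ ≤ (e / σ) ^ (1 / 2 : ℝ) := Real.rpow_le_rpow S0 Sle (by norm_num)
        _ = _ := by
          rw [Real.div_rpow he0 hσ.le, Real.sqrt_eq_rpow, Real.rpow_neg hσ.le]; rfl
    have b2 : ρ ^ (1 - A) ≤ 2 * d ^ (1 - A) :=
      rpow_le_two_mul_rpow hρ hd (by linarith) (by linarith) (by linarith) (by linarith)
    have b3 : σ ^ (1 - B) ≤ σ ^ (-1 : ℝ) * d ^ (2 - B) := by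
      rw [show 1 - B = -1 + (2 - B) by ring, Real.rpow_add hσ]
      gcongr
    have : S ^ (r / 2) * ρ ^ (1 - A) * σ ^ (1 - B)
        ≤ d ^ (1 - γ) * (2 * (Real.sqrt e * σ ^ (-(3 / 2) : ℝ))) := by
      calc _ ≤ (Real.sqrt e * σ ^ (-(1 / 2) : ℝ)) * (2 * d ^ (1 - A))
            * (σ ^ (-1 : ℝ) * d ^ (2 - B)) := by gcongr
        _ = _ := by
          rw [show (-(3 / 2) : ℝ) = -(1 / 2) + -1 by norm_num, Real.rpow_add hσ,
            show 1 - γ = (1 - A) + (2 - B) by linarith, Real.rpow_add hd]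
          ring
    refine (ENNReal.ofReal_le_ofReal this).trans ?_
    rw [ENNReal.ofReal_mul (by positivity)]
    refine mul_le_mul_right ?_ _
    unfold densityMajorant
    rw [Set.indicator_of_mem (show σ ∈ Set.Ici (e / 2) from he2), add_assoc]
    exact le_self_add
  · have b2 : ρ ^ (1 - A) ≤ 2 * σ ^ (1 - A) :=
      rpow_le_two_mul_rpow hρ hσ (by linarith) (by linarith) (by linarith) (by linarith)
    have b3 : σ ^ (-γ) ≤ d ^ (-γ) := Real.rpow_le_rpow_of_nonpos hd hσd.le (by linarith)
    have b4 : S ^ (r / 2) * ρ ^ (1 - A) * σ ^ (1 - B) ≤ S ^ (r / 2) * (2 * d ^ (-γ)) := by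
      calc _ ≤ S ^ (r / 2) * (2 * σ ^ (1 - A)) * σ ^ (1 - B) := by gcongr
        _ = S ^ (r / 2) * (2 * σ ^ (-γ)) := by
          rw [show -γ = (1 - A) + (1 - B) by linarith, Real.rpow_add hσ]; ring
        _ ≤ _ := by gcongr
    rcases hs with rfl | rfl
    · have : S ^ (r / 2) * ρ ^ (1 - A) * σ ^ (1 - B) ≤ d ^ (1 - γ) * (2 / d) := by
        calc _ ≤ 1 * (2 * d ^ (-γ)) := by
              refine b4.trans ?_
              gcongr
              exact Real.rpow_le_one S0 S1 (by linarith)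
          _ = _ := by
            rw [show 1 - γ = 1 + -γ by ring, Real.rpow_add hd, Real.rpow_one]; field_simp
      refine (ENNReal.ofReal_le_ofReal this).trans ?_
      rw [ENNReal.ofReal_mul (by positivity)]
      refine mul_le_mul_right ?_ _
      unfold densityMajorant
      rw [Set.indicator_of_mem (s := Set.Icc _ _) (Set.mem_Icc.mpr ⟨by linarith, by linarith⟩),
        add_comm (Set.indicator _ _ _), add_assoc]
      exact le_self_add
    · have b5 : S ≤ (d / σ) ^ 2 := by
        rw [hS, angleDefect, div_pow, div_le_div_iff₀ (by positivity) (by positivity)]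
        have : (d ^ 2 - (ρ - σ) ^ 2) * σ ^ 2 ≤ d ^ 2 * (4 * ρ * σ) := by
          have e1 : (d ^ 2 - (ρ - σ) ^ 2) * σ ^ 2 ≤ d ^ 2 * σ ^ 2 := by
            gcongr; nlinarith [sq_nonneg (ρ - σ)]
          have e2 : d ^ 2 * σ ^ 2 ≤ d ^ 2 * (4 * ρ * σ) := by
            gcongr; nlinarith
          linarith
        linarith
      have : S ^ (r / 2) * ρ ^ (1 - A) * σ ^ (1 - B)
          ≤ d ^ (1 - γ) * (2 * d ^ (r - 1) * σ ^ (-r)) := by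
        calc _ ≤ ((d / σ) ^ 2) ^ (r / 2) * (2 * d ^ (-γ)) := by
              refine b4.trans ?_
              gcongr
          _ = _ := by
            rw [← Real.rpow_natCast_mul (by positivity), Real.div_rpow hd.le hσ.le,
              show ((2 : ℕ) : ℝ) * (r / 2) = r by push_cast; ring, Real.rpow_neg hσ.le,
              show 1 - γ = 1 + -γ by ring, Real.rpow_add hd, Real.rpow_one,
              Real.rpow_sub hd, Real.rpow_one]
            field_simp
      refine (ENNReal.ofReal_le_ofReal this).trans ?_
      rw [ENNReal.ofReal_mul (by positivity)]
      refine mul_le_mul_right ?_ _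
      unfold densityMajorant
      rw [Set.indicator_of_mem (s := Set.Ioi d) (Set.mem_Ioi.mpr hσd)]
      exact le_add_self

theorem lintegral_Ioi_const_mul_rpow {a c k : ℝ} (ha : a < -1) (hc : 0 < c) (hk : 0 ≤ k) :
    ∫⁻ x in Set.Ioi c, ENNReal.ofReal (k * x ^ a)
      = ENNReal.ofReal (k * (-c ^ (a + 1) / (a + 1))) := by
  rw [← integral_Ioi_rpow_of_lt ha hc, ← integral_const_mul,
    ofReal_integral_eq_lintegral_ofReal ((integrableOn_Ioi_rpow_of_lt ha hc).const_mul k)]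
  filter_upwards [self_mem_ae_restrict measurableSet_Ioi] with x hx
  have : 0 < x := hc.trans hx
  simp only [Pi.zero_apply]
  positivity

theorem measurable_densityMajorant (r s d : ℝ) :
    Measurable fun z : ℝ × ℝ => densityMajorant r s d z.1 z.2 := by
  unfold densityMajorant
  have h1 : MeasurableSet {z : ℝ × ℝ | z.2 ∈ Set.Ici (s * (z.1 - d) / 2)} :=
    measurableSet_le (by fun_prop) measurable_snd
  have h2 : MeasurableSet {z : ℝ × ℝ | z.2 ∈ Set.Icc ((z.1 - d) / 2) ((z.1 + d) / 2)} :=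
    (measurableSet_le (by fun_prop) measurable_snd).inter
      (measurableSet_le measurable_snd (by fun_prop))
  have h3 : MeasurableSet {z : ℝ × ℝ | z.2 ∈ Set.Ioi d} :=
    measurableSet_lt measurable_const measurable_snd
  refine (Measurable.add ?_ ?_).add ?_
  · exact Measurable.indicator (f := fun z : ℝ × ℝ =>
      ENNReal.ofReal (2 * (Real.sqrt (s * (z.1 - d)) * z.2 ^ (-(3 / 2) : ℝ)))) (by fun_prop) h1
  · exact Measurable.indicator (f := fun z : ℝ × ℝ => ENNReal.ofReal (2 / d)) (by fun_prop) h2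
  · exact Measurable.indicator (f := fun z : ℝ × ℝ =>
      ENNReal.ofReal (2 * d ^ (r - 1) * z.2 ^ (-r))) (by fun_prop) h3

theorem lintegral_densityMajorant_le {r d : ℝ} (hr : 1 < r) (hd : 0 < d) (s v : ℝ) :
    ∫⁻ σ, densityMajorant r s d v σ ≤ ENNReal.ofReal (8 + 2 / (r - 1)) := by
  unfold densityMajorant
  have m1 : Measurable fun σ : ℝ => (Set.Ici (s * (v - d) / 2)).indicator
      (fun σ => ENNReal.ofReal (2 * (Real.sqrt (s * (v - d)) * σ ^ (-(3 / 2) : ℝ)))) σ :=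
    Measurable.indicator (by fun_prop) measurableSet_Ici
  have m2 : Measurable fun σ : ℝ => (Set.Icc ((v - d) / 2) ((v + d) / 2)).indicator
      (fun _ => ENNReal.ofReal (2 / d)) σ :=
    Measurable.indicator (by fun_prop) measurableSet_Icc
  rw [lintegral_add_left, lintegral_add_left m1, lintegral_indicator measurableSet_Ici,
    lintegral_indicator measurableSet_Icc, lintegral_indicator measurableSet_Ioi]
  swap
  · exact m1.add m2
  have i1 : ∫⁻ σ in Set.Ici (s * (v - d) / 2),
      ENNReal.ofReal (2 * (Real.sqrt (s * (v - d)) * σ ^ (-(3 / 2) : ℝ)))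
        ≤ ENNReal.ofReal 6 := by
    generalize s * (v - d) = e
    rcases le_or_gt e 0 with he | he
    · rw [Real.sqrt_eq_zero_of_nonpos he]; simp
    rw [setLIntegral_congr Ioi_ae_eq_Ici.symm]
    simp_rw [← mul_assoc]
    rw [lintegral_Ioi_const_mul_rpow (by norm_num) (by positivity) (by positivity)]
    apply ENNReal.ofReal_le_ofReal
    rw [show (-(3 / 2) + 1 : ℝ) = -(1 / 2) by norm_num, Real.rpow_neg (by positivity),
      ← Real.sqrt_eq_rpow, Real.sqrt_div he.le]
    have e1 : 0 < Real.sqrt e := Real.sqrt_pos.mpr he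
    have e2 : Real.sqrt 2 ≤ 3 / 2 := by
      rw [Real.sqrt_le_left (by norm_num)]; norm_num
    have : 2 * Real.sqrt e * (-(Real.sqrt e / Real.sqrt 2)⁻¹ / -(1 / 2)) = 4 * Real.sqrt 2 := by
      field_simp
      norm_num
    rw [this]
    linarith
  have i2 : ∫⁻ σ in Set.Icc ((v - d) / 2) ((v + d) / 2), ENNReal.ofReal (2 / d)
      = ENNReal.ofReal 2 := by
    rw [setLIntegral_const, Real.volume_Icc, ← ENNReal.ofReal_mul (by positivity)]
    congr 1
    field_simp
    ring
  have i3 : ∫⁻ σ in Set.Ioi d, ENNReal.ofReal (2 * d ^ (r - 1) * σ ^ (-r))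
      = ENNReal.ofReal (2 / (r - 1)) := by
    rw [lintegral_Ioi_const_mul_rpow (by linarith) hd (by positivity)]
    congr 1
    rw [show -r + 1 = -(r - 1) by ring, Real.rpow_neg hd.le, neg_div_neg_eq]
    have : d ^ (r - 1) ≠ 0 := (Real.rpow_pos_of_pos hd _).ne'
    field_simp
  rw [i2, i3]
  refine (add_le_add_left (add_le_add_left i1 _) _).trans ?_
  have : 0 < r - 1 := by linarith
  rw [← ENNReal.ofReal_add (by norm_num) (by norm_num), ← ENNReal.ofReal_add (by norm_num)
    (by positivity)]
  norm_num

/-- The half `σ ≤ ρ` of the bound for the density of `ρ + s σ`. -/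
theorem lintegral_density_half_le {r s d A B γ : ℝ} (hr : 1 < r) (hs : s = 1 ∨ s = -1)
    (hd : 0 < d) (hA : 0 ≤ A) (hA' : A ≤ 2) (hB' : B ≤ 2) (hγ : 0 ≤ γ) (hAB : A + B = 2 + γ)
    (h : ℝ → ℝ≥0∞) (hh : Measurable h) :
    ∫⁻ σ in Set.Ioi (0 : ℝ), ∫⁻ ρ in Set.Ioi (0 : ℝ),
      {z : ℝ × ℝ | IsTriangle d z.1 z.2 ∧ z.2 ≤ z.1}.indicator (fun z => ENNReal.ofReal
        (angleDefect s d z.1 z.2 ^ (r / 2) * z.1 ^ (1 - A) * z.2 ^ (1 - B)) * h (z.1 + s * z.2))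
        (ρ, σ)
      ≤ ENNReal.ofReal (d ^ (1 - γ)) * ENNReal.ofReal (8 + 2 / (r - 1)) * ∫⁻ v, h v := by
  have hm := measurable_densityMajorant r s d
  calc _ ≤ ∫⁻ σ in Set.Ioi (0 : ℝ), ∫⁻ ρ in Set.Ioi (0 : ℝ), ENNReal.ofReal (d ^ (1 - γ)) *
        (densityMajorant r s d (ρ + s * σ) σ * h (ρ + s * σ)) := by
        refine setLIntegral_mono' measurableSet_Ioi fun σ hσ =>
          setLIntegral_mono' measurableSet_Ioi fun ρ hρ => ?_
        by_cases ht : IsTriangle d ρ σ ∧ σ ≤ ρ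
        · rw [Set.indicator_of_mem (by simpa using ht), ← mul_assoc]
          exact mul_le_mul_left
            (density_le hr hs hd hρ hσ ht.1 ht.2 hA hA' hB' hγ hAB) _
        · rw [Set.indicator_of_notMem (by simpa using ht)]
          exact zero_le
    _ ≤ ∫⁻ σ, ∫⁻ ρ, ENNReal.ofReal (d ^ (1 - γ)) *
        (densityMajorant r s d (ρ + s * σ) σ * h (ρ + s * σ)) :=
        (setLIntegral_le_lintegral _ _).trans
          (lintegral_mono fun σ => setLIntegral_le_lintegral _ _)
    _ = ENNReal.ofReal (d ^ (1 - γ)) *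
          ∫⁻ σ, ∫⁻ v, densityMajorant r s d v σ * h v := by
        rw [← lintegral_const_mul' _ _ ENNReal.ofReal_ne_top]
        refine lintegral_congr fun σ => ?_
        rw [lintegral_const_mul' _ _ ENNReal.ofReal_ne_top,
          lintegral_add_right_eq_self (fun v => densityMajorant r s d v σ * h v) (s * σ)]
    _ = ENNReal.ofReal (d ^ (1 - γ)) *
          ∫⁻ v, (∫⁻ σ, densityMajorant r s d v σ) * h v := by
        congr 1
        rw [lintegral_lintegral_swap]
        · refine lintegral_congr fun v => ?_
          exact lintegral_mul_const _ (Measurable.comp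
            (g := fun z : ℝ × ℝ => densityMajorant r s d z.1 z.2) (f := fun σ => (v, σ)) hm
            (by fun_prop))
        · exact (Measurable.mul (f := fun z : ℝ × ℝ => densityMajorant r s d z.2 z.1)
            (g := fun z : ℝ × ℝ => h z.2) (Measurable.comp
              (g := fun z : ℝ × ℝ => densityMajorant r s d z.1 z.2)
              (f := fun z : ℝ × ℝ => (z.2, z.1)) hm (by fun_prop))
            (hh.comp measurable_snd)).aemeasurable
    _ ≤ ENNReal.ofReal (d ^ (1 - γ)) *
          ∫⁻ v, ENNReal.ofReal (8 + 2 / (r - 1)) * h v := by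
        gcongr with v
        exact lintegral_densityMajorant_le hr hd s v
    _ = _ := by rw [lintegral_const_mul' _ _ ENNReal.ofReal_ne_top, mul_assoc]

theorem lintegral_comp_sign_mul {s : ℝ} (hs : s = 1 ∨ s = -1) (h : ℝ → ℝ≥0∞) :
    ∫⁻ v, h (s * v) = ∫⁻ v, h v := by
  rcases hs with rfl | rfl
  · simp
  · simpa using lintegral_neg_eq_self (μ := volume) h

/-- The functions `|η| ± |ξ - η|` on `ℝ³`, under the measure with density
`(1 ∓ cos θ)^{r/2} |η|^{-A} |ξ - η|^{-B}`, have a law whose density with respect to Lebesgue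
measure is bounded by a multiple of `|ξ|^{-γ}`, `A + B = 2 + γ`. -/
theorem lintegral_angleDefect_comp_le {r A B γ : ℝ} (hr : 1 < r) (hA : 0 ≤ A) (hA' : A ≤ 2)
    (hB : 0 ≤ B) (hB' : B ≤ 2) (hγ : 0 ≤ γ) (hAB : A + B = 2 + γ) {s₁ s₂ : ℝ}
    (hs₁ : s₁ = 1 ∨ s₁ = -1) (hs₂ : s₂ = 1 ∨ s₂ = -1) (h : ℝ → ℝ≥0∞) (hh : Measurable h)
    {ξ : EuclideanSpace ℝ (Fin 3)} (hξ : ξ ≠ 0) :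
    ∫⁻ η, ENNReal.ofReal (angleDefect (s₁ * s₂) ‖ξ‖ ‖η‖ ‖ξ - η‖ ^ (r / 2) * ‖η‖ ^ (-A)
        * ‖ξ - η‖ ^ (-B)) * h (s₁ * ‖η‖ + s₂ * ‖ξ - η‖)
      ≤ ENNReal.ofReal (4 * Real.pi * (8 + 2 / (r - 1)) * ‖ξ‖ ^ (-γ)) * ∫⁻ v, h v := by
  have hd : 0 < ‖ξ‖ := norm_pos_iff.mpr hξ
  have hr' : 0 < r - 1 := by linarith
  have hs : s₁ * s₂ = 1 ∨ s₁ * s₂ = -1 := by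
    rcases hs₁ with rfl | rfl <;> rcases hs₂ with rfl | rfl <;> simp
  have hss : s₁ * (s₁ * s₂) = s₂ := by rcases hs₁ with rfl | rfl <;> simp
  have hss' : s₂ * (s₁ * s₂) = s₁ := by rcases hs₂ with rfl | rfl <;> simp
  set s := s₁ * s₂ with hs_def
  have hb := lintegral_bipolar_le (fun ρ σ => ENNReal.ofReal
    (angleDefect s ‖ξ‖ ρ σ ^ (r / 2) * ρ ^ (-A) * σ ^ (-B)) * h (s₁ * ρ + s₂ * σ)) (by
      have := measurable_angleDefect s ‖ξ‖
      have h2 : Measurable fun z : ℝ × ℝ => h (s₁ * z.1 + s₂ * z.2) := hh.comp (by fun_prop)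
      exact Measurable.mul (by fun_prop) h2) hξ
  refine hb.trans ?_
  generalize ‖ξ‖ = d at *
  -- The two halves `σ ≤ ρ` and `ρ ≤ σ` are exchanged by swapping `η` and `ξ - η`.
  set f₁ : ℝ × ℝ → ℝ≥0∞ := {z : ℝ × ℝ | IsTriangle d z.1 z.2 ∧ z.2 ≤ z.1}.indicator
    (fun z => ENNReal.ofReal (angleDefect s d z.1 z.2 ^ (r / 2) * z.1 ^ (1 - A) * z.2 ^ (1 - B))
      * h (s₁ * (z.1 + s * z.2))) with hf₁
  set f₂ : ℝ × ℝ → ℝ≥0∞ := {z : ℝ × ℝ | IsTriangle d z.1 z.2 ∧ z.2 ≤ z.1}.indicator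
    (fun z => ENNReal.ofReal (angleDefect s d z.1 z.2 ^ (r / 2) * z.1 ^ (1 - B) * z.2 ^ (1 - A))
      * h (s₂ * (z.1 + s * z.2))) with hf₂
  have hset : MeasurableSet {z : ℝ × ℝ | IsTriangle d z.1 z.2 ∧ z.2 ≤ z.1} :=
    (measurableSet_isTriangle d).inter (measurableSet_le measurable_snd measurable_fst)
  have hf₁m : Measurable f₁ := by
    refine Measurable.indicator ?_ hset
    have := measurable_angleDefect s d
    have h2 : Measurable fun z : ℝ × ℝ => h (s₁ * (z.1 + s * z.2)) := hh.comp (by fun_prop)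
    exact Measurable.mul (by fun_prop) h2
  have I₁ := lintegral_density_half_le hr hs hd hA hA' hB' hγ hAB (fun v => h (s₁ * v))
    (hh.comp (by fun_prop))
  have I₂ := lintegral_density_half_le hr hs hd hB hB' hA' hγ ((add_comm B A).trans hAB)
    (fun v => h (s₂ * v)) (hh.comp (by fun_prop))
  rw [lintegral_comp_sign_mul hs₁] at I₁
  rw [lintegral_comp_sign_mul hs₂] at I₂
  calc _ ≤ ENNReal.ofReal (2 * Real.pi / d) * ∫⁻ ρ in Set.Ioi (0 : ℝ), ∫⁻ σ in Set.Ioi (0 : ℝ),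
          (f₁ (ρ, σ) + f₂ (σ, ρ)) := by
        refine mul_le_mul_right ?_ _
        refine setLIntegral_mono' measurableSet_Ioi fun ρ hρ =>
          setLIntegral_mono' measurableSet_Ioi fun σ hσ => ?_
        have hρ' : 0 < ρ := hρ
        have hσ' : 0 < σ := hσ
        by_cases ht : IsTriangle d ρ σ
        swap
        · rw [Set.indicator_of_notMem (by simpa using ht)]
          exact zero_le
        rw [Set.indicator_of_mem (by simpa using ht)]
        have eρ : ∀ a : ℝ, ρ ^ (1 - a) = ρ * ρ ^ (-a) := fun a => by
          rw [sub_eq_add_neg, Real.rpow_add hρ', Real.rpow_one]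
        have eσ : ∀ a : ℝ, σ ^ (1 - a) = σ * σ ^ (-a) := fun a => by
          rw [sub_eq_add_neg, Real.rpow_add hσ', Real.rpow_one]
        rcases le_total σ ρ with hle | hle
        · refine le_trans (le_of_eq ?_) le_self_add
          rw [hf₁, Set.indicator_of_mem (by exact ⟨ht, hle⟩)]
          simp only
          rw [← mul_assoc, ← ENNReal.ofReal_mul (by positivity), mul_add, ← mul_assoc s₁, hss, eρ,
            eσ]
          congr 2
          ring
        · refine le_trans (le_of_eq ?_) le_add_self
          rw [hf₂, Set.indicator_of_mem (by exact ⟨ht.swap, hle⟩)]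
          simp only
          rw [← mul_assoc, ← ENNReal.ofReal_mul (by positivity), mul_add, ← mul_assoc s₂, hss', eρ,
            eσ, angleDefect_swap hs, add_comm (s₁ * ρ)]
          congr 2
          ring
    _ = ENNReal.ofReal (2 * Real.pi / d) *
          ((∫⁻ σ in Set.Ioi (0 : ℝ), ∫⁻ ρ in Set.Ioi (0 : ℝ), f₁ (ρ, σ))
          + ∫⁻ ρ in Set.Ioi (0 : ℝ), ∫⁻ σ in Set.Ioi (0 : ℝ), f₂ (σ, ρ)) := by
        congr 1
        rw [lintegral_lintegral_swap (f := fun σ ρ => f₁ (ρ, σ))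
          (hf₁m.comp measurable_swap).aemeasurable, ← lintegral_add_left]
        · refine lintegral_congr fun ρ => ?_
          rw [lintegral_add_left]
          exact hf₁m.comp (measurable_const.prodMk measurable_id)
        · exact hf₁m.lintegral_prod_right'
    _ ≤ ENNReal.ofReal (2 * Real.pi / d) *
          (ENNReal.ofReal (d ^ (1 - γ)) * ENNReal.ofReal (8 + 2 / (r - 1)) * (∫⁻ v, h v)
          + ENNReal.ofReal (d ^ (1 - γ)) * ENNReal.ofReal (8 + 2 / (r - 1)) * ∫⁻ v, h v) :=
        mul_le_mul_right (add_le_add I₁ I₂) _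
    _ = _ := by
        rw [← two_mul, ← mul_assoc, ← mul_assoc, ← ENNReal.ofReal_ofNat 2,
          ← ENNReal.ofReal_mul (by positivity), ← ENNReal.ofReal_mul (by positivity),
          ← ENNReal.ofReal_mul (by positivity)]
        congr 2
        rw [sub_eq_add_neg 1 γ, Real.rpow_add hd, Real.rpow_one]
        field_simp
        norm_num

/-! ### Symbols controlled by the angle between the frequencies -/

/-- The space component `ξ` of `p = (τ, ξ)`. -/
noncomputable def spacePart (p : SpaceTime) : EuclideanSpace ℝ (Fin 3) :=
  WithLp.toLp 2 fun j => p j.succ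

theorem spaceNorm_eq_norm (p : SpaceTime) : spaceNorm p = ‖spacePart p‖ := by
  rw [EuclideanSpace.norm_eq]
  simp [spaceNorm, spacePart]

theorem spacePart_sub (p p' : SpaceTime) : spacePart (p - p') = spacePart p - spacePart p' := by
  ext j; simp [spacePart]

theorem spaceNorm_nonneg (p : SpaceTime) : 0 ≤ spaceNorm p := Real.sqrt_nonneg _

theorem measurable_spaceNorm : Measurable spaceNorm := by
  unfold spaceNorm; fun_prop

theorem japaneseBracket_pos (x : ℝ) : 0 < japaneseBracket x := by
  unfold japaneseBracket; positivity

theorem measurable_japaneseBracket : Measurable japaneseBracket := by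
  unfold japaneseBracket; fun_prop

theorem measurable_xWeight (s b : ℝ) : Measurable (xWeight s b) := by
  have := measurable_spaceNorm
  have := measurable_japaneseBracket
  unfold xWeight
  fun_prop

theorem xWeight_nonneg (s b : ℝ) (p : SpaceTime) : 0 ≤ xWeight s b p :=
  mul_nonneg (Real.rpow_nonneg (spaceNorm_nonneg p) s)
    (Real.rpow_nonneg (japaneseBracket_pos _).le b)

theorem xWeight_pos (s b : ℝ) {p : SpaceTime} (hp : spaceNorm p ≠ 0) : 0 < xWeight s b p :=
  mul_pos (Real.rpow_pos_of_pos ((spaceNorm_nonneg p).lt_of_ne' hp) s)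
    (Real.rpow_pos_of_pos (japaneseBracket_pos _) b)

theorem measurePreserving_time_space :
    MeasurePreserving (fun p : SpaceTime => (p 0, spacePart p)) := by
  have e1 := (EuclideanSpace.volume_preserving_symm_measurableEquiv_toLp (Fin 4))
  have e2 := volume_preserving_piFinSuccAbove (fun _ : Fin 4 => ℝ) 0
  have e3 := (MeasurePreserving.id (volume : Measure ℝ)).prod
    (PiLp.volume_preserving_toLp (Fin 3))
  exact e3.comp (e2.comp e1)

theorem ae_time_ne_zero_and_spaceNorm_ne_zero :
    ∀ᵐ p : SpaceTime, p 0 ≠ 0 ∧ spaceNorm p ≠ 0 := by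
  have h1 : ∀ᵐ z : ℝ × EuclideanSpace ℝ (Fin 3), z.1 ≠ 0 :=
    Measure.quasiMeasurePreserving_fst.ae (Measure.ae_ne volume 0)
  have h2 : ∀ᵐ z : ℝ × EuclideanSpace ℝ (Fin 3), z.2 ≠ 0 :=
    Measure.quasiMeasurePreserving_snd.ae (Measure.ae_ne volume 0)
  filter_upwards [measurePreserving_time_space.quasiMeasurePreserving.ae h1,
    measurePreserving_time_space.quasiMeasurePreserving.ae h2] with p hp hp'
  exact ⟨hp, by rw [spaceNorm_eq_norm]; exact norm_ne_zero_iff.mpr hp'⟩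

/-- Symbols which are bounded by a multiple of the square root of the angle defect of the two
frequencies, with the sign `sgn τ sgn τ'` of the interaction. -/
structure IsNullSymbol (m : SpaceTime → SpaceTime → ℂ) : Prop where
  measurable : Measurable (Function.uncurry m)
  norm_sq_le : ∀ p p' : SpaceTime, p 0 ≠ 0 → p' 0 ≠ 0 → spaceNorm p ≠ 0 → spaceNorm p' ≠ 0 →
    ‖m p p'‖ ^ 2 ≤ 4 * angleDefect (Real.sign (p 0) * Real.sign (p' 0)) (spaceNorm (p + p'))
      (spaceNorm p) (spaceNorm p')

theorem sq_spaceNorm (p : SpaceTime) : spaceNorm p ^ 2 = ∑ j : Fin 3, p j.succ ^ 2 :=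
  Real.sq_sqrt (Finset.sum_nonneg fun _ _ => sq_nonneg _)

/-- The law of cosines: the angle defect is `|s η̂ - ζ̂|² / 4`, with the unit vectors `η̂`, `ζ̂`. -/
theorem four_mul_angleDefect {s : ℝ} (hs : s = 1 ∨ s = -1) {p p' : SpaceTime}
    (hp : spaceNorm p ≠ 0) (hp' : spaceNorm p' ≠ 0) :
    4 * angleDefect s (spaceNorm (p + p')) (spaceNorm p) (spaceNorm p')
      = 2 * (1 - s * ∑ j : Fin 3, (p j.succ / spaceNorm p) * (p' j.succ / spaceNorm p')) := by
  have hadd : spaceNorm (p + p') ^ 2 = spaceNorm p ^ 2 + spaceNorm p' ^ 2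
      + 2 * ∑ j : Fin 3, p j.succ * p' j.succ := by
    simp only [sq_spaceNorm, Fin.sum_univ_three, PiLp.add_apply]
    ring
  have hsum : ∑ j : Fin 3, (p j.succ / spaceNorm p) * (p' j.succ / spaceNorm p')
      = (∑ j : Fin 3, p j.succ * p' j.succ) / (spaceNorm p * spaceNorm p') := by
    rw [Finset.sum_div]
    refine Finset.sum_congr rfl fun j _ => ?_
    field_simp
  rw [hsum, angleDefect, hadd]
  rcases hs with rfl | rfl <;> · field_simp; ring

theorem sum_sq_div_spaceNorm {p : SpaceTime} (hp : spaceNorm p ≠ 0) :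
    ∑ j : Fin 3, (p j.succ / spaceNorm p) ^ 2 = 1 := by
  simp_rw [div_pow]
  rw [← Finset.sum_div, ← sq_spaceNorm, div_self (pow_ne_zero 2 hp)]

theorem sign_eq_one_or_neg_one {x : ℝ} (hx : x ≠ 0) : Real.sign x = 1 ∨ Real.sign x = -1 := by
  rcases lt_or_gt_of_ne hx with h | h
  · exact Or.inr (Real.sign_of_neg h)
  · exact Or.inl (Real.sign_of_pos h)

theorem sign_mul_sign_eq {x y : ℝ} (hx : x ≠ 0) (hy : y ≠ 0) :
    Real.sign x * Real.sign y = 1 ∨ Real.sign x * Real.sign y = -1 := by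
  rcases sign_eq_one_or_neg_one hx with h | h <;>
  rcases sign_eq_one_or_neg_one hy with h' | h' <;> rw [h, h'] <;> norm_num

theorem measurable_sign : Measurable Real.sign := by
  unfold Real.sign
  exact Measurable.ite measurableSet_Iio measurable_const
    (Measurable.ite measurableSet_Ioi measurable_const measurable_const)

theorem measurable_spaceSymbol (j : Fin 3) : Measurable (spaceSymbol j) := by
  have := measurable_spaceNorm
  unfold spaceSymbol
  fun_prop

theorem measurable_timeSymbol : Measurable timeSymbol := by
  have := measurable_sign
  unfold timeSymbol
  fun_prop

/-- `|a × c|² = 1 - cos² ≤ 2 (1 - s cos)` for unit vectors `a`, `c`. -/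
theorem isNullSymbol_qSpaceSymbol (i j : Fin 3) : IsNullSymbol (qSpaceSymbol i j) where
  measurable := by
    have h := measurable_spaceSymbol
    exact (((h i).comp measurable_fst).mul ((h j).comp measurable_snd)).sub
      (((h j).comp measurable_fst).mul ((h i).comp measurable_snd))
  norm_sq_le p p' h0 h0' hp hp' := by
    have hs := sign_mul_sign_eq h0 h0'
    rw [four_mul_angleDefect hs hp hp']
    generalize Real.sign (p 0) * Real.sign (p' 0) = s at hs
    have e1 := sum_sq_div_spaceNorm hp
    have e2 := sum_sq_div_spaceNorm hp'
    have : qSpaceSymbol i j p p' = ((-((p i.succ / spaceNorm p) * (p' j.succ / spaceNorm p')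
        - (p j.succ / spaceNorm p) * (p' i.succ / spaceNorm p')) : ℝ) : ℂ) := by
      simp only [qSpaceSymbol, spaceSymbol]
      push_cast
      linear_combination ((p i.succ : ℂ) / spaceNorm p * ((p' j.succ : ℂ) / spaceNorm p')
        - (p j.succ : ℂ) / spaceNorm p * ((p' i.succ : ℂ) / spaceNorm p')) * Complex.I_sq
    rw [this, Complex.norm_real, Real.norm_eq_abs, sq_abs]
    generalize ha : (fun j : Fin 3 => p j.succ / spaceNorm p) = a
    generalize hc : (fun j : Fin 3 => p' j.succ / spaceNorm p') = c
    simp only [fun j => congrFun ha j, fun j => congrFun hc j] at e1 e2 ⊢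
    have key : (a i * c j - a j * c i) ^ 2 ≤ 1 - (∑ j, a j * c j) ^ 2 := by
      have lag : 1 - (∑ j, a j * c j) ^ 2 = (a 0 * c 1 - a 1 * c 0) ^ 2
          + (a 0 * c 2 - a 2 * c 0) ^ 2 + (a 1 * c 2 - a 2 * c 1) ^ 2 := by
        rw [show (1 : ℝ) = (∑ j, a j ^ 2) * ∑ j, c j ^ 2 by rw [e1, e2, one_mul]]
        simp only [Fin.sum_univ_three]
        ring
      rw [lag]
      fin_cases i <;> fin_cases j <;> simp <;>
        nlinarith [sq_nonneg (a 0 * c 1 - a 1 * c 0), sq_nonneg (a 0 * c 2 - a 2 * c 0),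
          sq_nonneg (a 1 * c 2 - a 2 * c 1)]
    generalize ∑ j, a j * c j = x at key ⊢
    rcases hs with rfl | rfl
    · nlinarith [sq_nonneg (1 - x), sq_nonneg (a i * c j - a j * c i)]
    · nlinarith [sq_nonneg (1 + x), sq_nonneg (a i * c j - a j * c i)]

/-- `|s c - s' a|² = 2 (1 - s s' cos)` for unit vectors `a`, `c`. -/
theorem isNullSymbol_qTimeSymbol (j : Fin 3) : IsNullSymbol (qTimeSymbol j) where
  measurable := by
    have h := measurable_spaceSymbol j
    have h' := measurable_timeSymbol
    exact ((h'.comp measurable_fst).mul (h.comp measurable_snd)).sub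
      ((h.comp measurable_fst).mul (h'.comp measurable_snd))
  norm_sq_le p p' h0 h0' hp hp' := by
    have hs := sign_eq_one_or_neg_one h0
    have hs' := sign_eq_one_or_neg_one h0'
    have hss := sign_mul_sign_eq h0 h0'
    rw [four_mul_angleDefect hss hp hp']
    have e1 := sum_sq_div_spaceNorm hp
    have e2 := sum_sq_div_spaceNorm hp'
    have : qTimeSymbol j p p' = ((-(Real.sign (p 0) * (p' j.succ / spaceNorm p')
        - (p j.succ / spaceNorm p) * Real.sign (p' 0)) : ℝ) : ℂ) := by
      simp only [qTimeSymbol, spaceSymbol, timeSymbol]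
      push_cast
      linear_combination ((Real.sign (p 0) : ℂ) * ((p' j.succ : ℂ) / spaceNorm p')
        - (p j.succ : ℂ) / spaceNorm p * (Real.sign (p' 0) : ℂ)) * Complex.I_sq
    rw [this, Complex.norm_real, Real.norm_eq_abs, sq_abs]
    generalize Real.sign (p 0) = s at hs
    generalize Real.sign (p' 0) = s' at hs'
    generalize ha : (fun j : Fin 3 => p j.succ / spaceNorm p) = a
    generalize hc : (fun j : Fin 3 => p' j.succ / spaceNorm p') = c
    simp only [fun j => congrFun ha j, fun j => congrFun hc j] at e1 e2 ⊢
    have e3 : ∑ j, (s * c j - a j * s') ^ 2 = 2 * (1 - s * s' * ∑ j, a j * c j) := by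
      simp only [Fin.sum_univ_three] at e1 e2 ⊢
      have hs2 : s ^ 2 = 1 := by rcases hs with rfl | rfl <;> norm_num
      have hs2' : s' ^ 2 = 1 := by rcases hs' with rfl | rfl <;> norm_num
      linear_combination s ^ 2 * e2 + s' ^ 2 * e1 + hs2 + hs2'
    rw [← e3, neg_sq]
    exact Finset.single_le_sum (f := fun j => (s * c j - a j * s') ^ 2)
      (fun _ _ => sq_nonneg _) (Finset.mem_univ j)

/-- `|s s' - cos|² = (1 - s s' cos)² ≤ 2 (1 - s s' cos)`. -/
theorem isNullSymbol_qZeroSymbol : IsNullSymbol qZeroSymbol where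
  measurable := by
    have h := measurable_spaceSymbol
    have h' := measurable_timeSymbol
    exact ((h'.comp measurable_fst).mul (h'.comp measurable_snd)).sub
      (Finset.measurable_sum _ fun j _ => ((h j).comp measurable_fst).mul
        ((h j).comp measurable_snd))
  norm_sq_le p p' h0 h0' hp hp' := by
    have hss := sign_mul_sign_eq h0 h0'
    rw [four_mul_angleDefect hss hp hp']
    have e1 := sum_sq_div_spaceNorm hp
    have e2 := sum_sq_div_spaceNorm hp'
    have : qZeroSymbol p p' = ((-(Real.sign (p 0) * Real.sign (p' 0)
        - ∑ j : Fin 3, (p j.succ / spaceNorm p) * (p' j.succ / spaceNorm p')) : ℝ) : ℂ) := by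
      simp only [qZeroSymbol, spaceSymbol, timeSymbol, Fin.sum_univ_three]
      push_cast
      linear_combination ((Real.sign (p 0) : ℂ) * (Real.sign (p' 0) : ℂ)
        - (p 1 : ℂ) / spaceNorm p * ((p' 1 : ℂ) / spaceNorm p')
        - (p 2 : ℂ) / spaceNorm p * ((p' 2 : ℂ) / spaceNorm p')
        - (p 3 : ℂ) / spaceNorm p * ((p' 3 : ℂ) / spaceNorm p'))
          * Complex.I_sq
    rw [this, Complex.norm_real, Real.norm_eq_abs, sq_abs]
    generalize Real.sign (p 0) * Real.sign (p' 0) = s at hss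
    generalize ha : (fun j : Fin 3 => p j.succ / spaceNorm p) = a
    generalize hc : (fun j : Fin 3 => p' j.succ / spaceNorm p') = c
    simp only [fun j => congrFun ha j, fun j => congrFun hc j] at e1 e2 ⊢
    have hcs : (∑ j, a j * c j) ^ 2 ≤ 1 := by
      simpa [e1, e2] using Finset.sum_mul_sq_le_sq_mul_sq Finset.univ a c
    have hx := abs_le.mp ((sq_le_one_iff_abs_le_one _).mp hcs)
    generalize ∑ j, a j * c j = x at hx
    rcases hss with rfl | rfl <;> nlinarith

/-! ### The bilinear estimate for null symbols -/

/-- The function `⟨x⟩^{-br}`, integrable for `br > 1`. -/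
noncomputable def bracketKernel (b r x : ℝ) : ℝ≥0∞ := ENNReal.ofReal (japaneseBracket x ^ (-(b * r)))

theorem measurable_bracketKernel (b r : ℝ) : Measurable (bracketKernel b r) := by
  have := measurable_japaneseBracket
  unfold bracketKernel
  fun_prop

theorem lintegral_bracketKernel_lt_top {b r : ℝ} (h : 1 < b * r) :
    ∫⁻ x, bracketKernel b r x < ∞ := by
  have := integrable_rpow_neg_one_add_norm_sq (E := ℝ) (μ := volume) (r := b * r) (by simpa using h)
  have h2 := this.lintegral_lt_top
  refine lt_of_le_of_lt (lintegral_mono fun x => ?_) h2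
  unfold bracketKernel japaneseBracket
  apply ENNReal.ofReal_le_ofReal
  rw [Real.sqrt_eq_rpow, ← Real.rpow_mul (by positivity), Real.norm_eq_abs, sq_abs]
  apply le_of_eq
  congr 1
  ring

theorem abs_eq_sign_mul {x : ℝ} : |x| = Real.sign x * x := by
  rcases lt_trichotomy x 0 with h | rfl | h
  · rw [abs_of_neg h, Real.sign_of_neg h]; ring
  · simp
  · rw [abs_of_pos h, Real.sign_of_pos h]; ring

theorem japaneseBracket_abs_sub {x : ℝ} (hx : x ≠ 0) (ρ : ℝ) :
    japaneseBracket (|x| - ρ) = japaneseBracket (x - Real.sign x * ρ) := by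
  unfold japaneseBracket
  rw [abs_eq_sign_mul]
  rcases sign_eq_one_or_neg_one hx with h | h <;> · rw [h]; congr 1; ring

theorem isTriangle_spaceNorm (p p' : SpaceTime) :
    IsTriangle (spaceNorm p) (spaceNorm p') (spaceNorm (p - p')) := by
  simp only [spaceNorm_eq_norm, spacePart_sub]
  constructor
  · rw [abs_le]
    have h1 := norm_le_norm_add_norm_sub (spacePart p) (spacePart p')
    have h2 := norm_sub_le (spacePart p) (spacePart p')
    constructor <;> linarith
  · have := norm_add_le (spacePart p') (spacePart p - spacePart p')
    rwa [add_sub_cancel] at this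

/-- The contribution of the interaction with signs `s₁`, `s₂` to the `r`-th power of the kernel of
the bilinear form, as a function of `τ'` and `η`. -/
noncomputable def interaction (r b A B s₁ s₂ τ : ℝ) (ξ : EuclideanSpace ℝ (Fin 3))
    (z : ℝ × EuclideanSpace ℝ (Fin 3)) : ℝ≥0∞ :=
  ENNReal.ofReal (angleDefect (s₁ * s₂) ‖ξ‖ ‖z.2‖ ‖ξ - z.2‖ ^ (r / 2) * ‖z.2‖ ^ (-A)
    * ‖ξ - z.2‖ ^ (-B)) *
  (bracketKernel b r (z.1 - s₁ * ‖z.2‖) * bracketKernel b r (τ - z.1 - s₂ * ‖ξ - z.2‖))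

theorem measurable_interaction_weight (r A B s : ℝ) (ξ : EuclideanSpace ℝ (Fin 3)) :
    Measurable fun η : EuclideanSpace ℝ (Fin 3) => ENNReal.ofReal
      (angleDefect s ‖ξ‖ ‖η‖ ‖ξ - η‖ ^ (r / 2) * ‖η‖ ^ (-A) * ‖ξ - η‖ ^ (-B)) := by
  unfold angleDefect
  fun_prop

theorem measurable_interaction (r b A B s₁ s₂ τ : ℝ) (ξ : EuclideanSpace ℝ (Fin 3)) :
    Measurable (interaction r b A B s₁ s₂ τ ξ) := by
  have hk := measurable_bracketKernel b r
  refine ((measurable_interaction_weight r A B (s₁ * s₂) ξ).comp measurable_snd).mul ?_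
  fun_prop

/-- After the substitution `τ' = t + s₁ |η|` the integral over `τ'` is a function of
`s₁ |η| + s₂ |ξ - η|` only. -/
theorem lintegral_interaction_le {r b A B γ : ℝ} (hr : 1 < r) (hA : 0 ≤ A) (hA' : A ≤ 2)
    (hB : 0 ≤ B) (hB' : B ≤ 2) (hγ : 0 ≤ γ) (hAB : A + B = 2 + γ) {s₁ s₂ : ℝ}
    (hs₁ : s₁ = 1 ∨ s₁ = -1) (hs₂ : s₂ = 1 ∨ s₂ = -1) (τ : ℝ)
    {ξ : EuclideanSpace ℝ (Fin 3)} (hξ : ξ ≠ 0) :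
    ∫⁻ z, interaction r b A B s₁ s₂ τ ξ z
      ≤ ENNReal.ofReal (4 * Real.pi * (8 + 2 / (r - 1)) * ‖ξ‖ ^ (-γ)) *
        (∫⁻ x, bracketKernel b r x) ^ 2 := by
  set κ := bracketKernel b r with hκ
  have hκm : Measurable κ := measurable_bracketKernel b r
  set h : ℝ → ℝ≥0∞ := fun v => ∫⁻ t, κ t * κ (τ - t - v) with hh
  have hm2 : Measurable fun z : ℝ × ℝ => κ z.2 * κ (τ - z.2 - z.1) := by fun_prop
  have hhm : Measurable h := hm2.lintegral_prod_right'
  have hint : ∫⁻ v, h v = (∫⁻ x, κ x) ^ 2 := by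
    rw [hh, lintegral_lintegral_swap hm2.aemeasurable]
    have : ∀ t, ∫⁻ v, κ t * κ (τ - t - v) = κ t * ∫⁻ x, κ x := by
      intro t
      rw [lintegral_const_mul _ (by fun_prop), lintegral_sub_left_eq_self κ (τ - t)]
    simp_rw [this]
    rw [lintegral_mul_const _ hκm, sq]
  rw [Measure.volume_eq_prod, lintegral_prod_symm _
    (measurable_interaction r b A B s₁ s₂ τ ξ).aemeasurable, ← hint]
  refine le_trans (le_of_eq (lintegral_congr fun η => ?_))
    (lintegral_angleDefect_comp_le hr hA hA' hB hB' hγ hAB hs₁ hs₂ h hhm hξ)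
  simp only [interaction]
  rw [lintegral_const_mul' _ _ ENNReal.ofReal_ne_top,
    ← lintegral_add_right_eq_self _ (s₁ * ‖η‖)]
  congr 1
  refine lintegral_congr fun t => ?_
  rw [hκ]
  congr 2 <;> ring

/-- The kernel of the bilinear form with symbol `m`, relative to the weights of the norms. -/
noncomputable def relativeKernel (b α₁ α₂ : ℝ) (m : SpaceTime → SpaceTime → ℂ)
    (p p' : SpaceTime) : ℝ :=
  ‖m p' (p - p')‖ * ((xWeight α₁ b p')⁻¹ * (xWeight α₂ b (p - p'))⁻¹)

theorem inv_xWeight_rpow (α b r : ℝ) (p : SpaceTime) :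
    (xWeight α b p)⁻¹ ^ r = spaceNorm p ^ (-(α * r)) *
      japaneseBracket (|p 0| - spaceNorm p) ^ (-(b * r)) := by
  have h1 := spaceNorm_nonneg p
  have h2 := (japaneseBracket_pos (|p 0| - spaceNorm p)).le
  rw [xWeight, Real.inv_rpow (by positivity), Real.mul_rpow (by positivity) (by positivity),
    ← Real.rpow_mul h1, ← Real.rpow_mul h2, mul_inv, ← Real.rpow_neg h1, ← Real.rpow_neg h2]

theorem relativeKernel_rpow_le {r b α₁ α₂ : ℝ} (hr : 1 < r) {m : SpaceTime → SpaceTime → ℂ}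
    (hm : IsNullSymbol m) {p p' : SpaceTime} (hp : spaceNorm p ≠ 0) (h0 : p' 0 ≠ 0)
    (h0' : (p - p') 0 ≠ 0) (h1 : spaceNorm p' ≠ 0) (h2 : spaceNorm (p - p') ≠ 0) :
    ENNReal.ofReal (relativeKernel b α₁ α₂ m p p') ^ r
      ≤ ENNReal.ofReal (2 ^ r) * interaction r b (α₁ * r) (α₂ * r) (Real.sign (p' 0))
        (Real.sign ((p - p') 0)) (p 0) (spacePart p) (p' 0, spacePart p') := by
  have hsq := hm.norm_sq_le p' (p - p') h0 h0' h1 h2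
  rw [add_sub_cancel] at hsq
  have hs := sign_mul_sign_eq h0 h0'
  have S0 := angleDefect_nonneg hs ((spaceNorm_nonneg p).lt_of_ne' hp)
    ((spaceNorm_nonneg p').lt_of_ne' h1) ((spaceNorm_nonneg _).lt_of_ne' h2)
    (isTriangle_spaceNorm p p')
  have hW1 := (inv_nonneg.mpr (xWeight_nonneg α₁ b p'))
  have hW2 := (inv_nonneg.mpr (xWeight_nonneg α₂ b (p - p')))
  have hj1 := japaneseBracket_abs_sub h0 (spaceNorm p')
  have hj2 := japaneseBracket_abs_sub h0' (spaceNorm (p - p'))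
  have n1 := spaceNorm_nonneg p'
  have n2 := spaceNorm_nonneg (p - p')
  have j1 := japaneseBracket_pos (|p' 0| - spaceNorm p')
  have j2 := japaneseBracket_pos (|(p - p') 0| - spaceNorm (p - p'))
  rw [interaction]
  simp only [← spacePart_sub, ← spaceNorm_eq_norm]
  set S := angleDefect (Real.sign (p' 0) * Real.sign ((p - p') 0)) (spaceNorm p) (spaceNorm p')
    (spaceNorm (p - p')) with hS
  have hmr : ‖m p' (p - p')‖ ^ r ≤ 2 ^ r * S ^ (r / 2) := by
    calc ‖m p' (p - p')‖ ^ r = (‖m p' (p - p')‖ ^ 2) ^ (r / 2) := by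
          rw [← Real.rpow_natCast_mul (norm_nonneg _)]; congr 1; push_cast; ring
      _ ≤ (2 ^ 2 * S) ^ (r / 2) := by
          apply Real.rpow_le_rpow (by positivity) _ (by linarith)
          linarith
      _ = _ := by
          rw [Real.mul_rpow (by positivity) S0, ← Real.rpow_natCast_mul (by norm_num)]
          congr 2; push_cast; ring
  have e0 : p 0 - p' 0 = (p - p') 0 := rfl
  rw [e0, bracketKernel, bracketKernel, ← hj1, ← hj2, ← ENNReal.ofReal_mul (by positivity),
    ← ENNReal.ofReal_mul (by positivity), ← ENNReal.ofReal_mul (by positivity),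
    ENNReal.ofReal_rpow_of_nonneg (by unfold relativeKernel; positivity) (by linarith)]
  apply ENNReal.ofReal_le_ofReal
  rw [relativeKernel, Real.mul_rpow (norm_nonneg _) (by positivity), Real.mul_rpow hW1 hW2,
    inv_xWeight_rpow, inv_xWeight_rpow]
  calc _ ≤ (2 ^ r * S ^ (r / 2)) * _ := mul_le_mul_of_nonneg_right hmr (by positivity)
    _ = _ := by ring

theorem measurable_relativeKernel {b α₁ α₂ : ℝ} {m : SpaceTime → SpaceTime → ℂ}
    (hm : IsNullSymbol m) (p : SpaceTime) : Measurable (relativeKernel b α₁ α₂ m p) := by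
  have h1 : Measurable fun p' => m p' (p - p') :=
    hm.measurable.comp (f := fun p' : SpaceTime => (p', p - p')) (by fun_prop)
  have h2 := measurable_xWeight α₁ b
  have h3 := measurable_xWeight α₂ b
  exact h1.norm.mul (h2.inv.mul (h3.comp (measurable_const.sub measurable_id)).inv)

/-- A constant for the kernel estimate: the factor `4` counts the choices of the two signs. -/
noncomputable def kernelConst (r b : ℝ) : ℝ≥0∞ :=
  ENNReal.ofReal (2 ^ r) * (4 * (ENNReal.ofReal (4 * Real.pi * (8 + 2 / (r - 1))) *
    (∫⁻ x, bracketKernel b r x) ^ 2))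

theorem kernelConst_lt_top {r b : ℝ} (h : 1 < b * r) : kernelConst r b < ∞ := by
  have := lintegral_bracketKernel_lt_top h
  unfold kernelConst
  finiteness

/-- The kernel estimate, which by Hölder's inequality is the bilinear estimate. -/
theorem lintegral_relativeKernel_rpow_le {r b α₀ α₁ α₂ : ℝ} (hr : 1 < r) (hα₀ : 0 ≤ α₀)
    (hα₁ : 0 ≤ α₁) (hα₂ : 0 ≤ α₂) (hα₁' : α₁ ≤ 2 / r) (hα₂' : α₂ ≤ 2 / r)
    (hscale : α₁ + α₂ - α₀ = 2 / r) {m : SpaceTime → SpaceTime → ℂ} (hm : IsNullSymbol m)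
    {p : SpaceTime} (hp : spaceNorm p ≠ 0) :
    ∫⁻ p', ENNReal.ofReal (relativeKernel b α₁ α₂ m p p') ^ r
      ≤ kernelConst r b * ENNReal.ofReal (spaceNorm p ^ (-(α₀ * r))) := by
  have hr0 : 0 < r := by linarith
  have hA' : α₁ * r ≤ 2 := (le_div_iff₀ hr0).mp hα₁'
  have hB' : α₂ * r ≤ 2 := (le_div_iff₀ hr0).mp hα₂'
  have hAB : α₁ * r + α₂ * r = 2 + α₀ * r := by
    have : (α₁ + α₂ - α₀) * r = 2 := by rw [hscale]; field_simp
    linarith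
  have hξ : spacePart p ≠ 0 := by
    rw [spaceNorm_eq_norm] at hp; exact norm_ne_zero_iff.mp hp
  set I : ℝ → ℝ → ℝ × EuclideanSpace ℝ (Fin 3) → ℝ≥0∞ := fun s₁ s₂ =>
    interaction r b (α₁ * r) (α₂ * r) s₁ s₂ (p 0) (spacePart p) with hI
  have hIm : ∀ s₁ s₂, Measurable (I s₁ s₂) := fun s₁ s₂ => measurable_interaction _ _ _ _ _ _ _ _
  have hIle : ∀ s₁ s₂, (s₁ = 1 ∨ s₁ = -1) → (s₂ = 1 ∨ s₂ = -1) →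
      ∫⁻ z, I s₁ s₂ z ≤ ENNReal.ofReal (4 * Real.pi * (8 + 2 / (r - 1))) *
        ENNReal.ofReal (spaceNorm p ^ (-(α₀ * r))) * (∫⁻ x, bracketKernel b r x) ^ 2 := by
    intro s₁ s₂ h₁ h₂
    have hr1 : 0 < r - 1 := by linarith
    rw [← ENNReal.ofReal_mul (by positivity), spaceNorm_eq_norm]
    exact lintegral_interaction_le hr (by positivity) hA' (by positivity) hB' (by positivity) hAB
      h₁ h₂ (p 0) hξ
  have hae := ae_time_ne_zero_and_spaceNorm_ne_zero
  have hae' := (Measure.measurePreserving_sub_left volume p).quasiMeasurePreserving.ae hae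
  calc _ ≤ ∫⁻ p' : SpaceTime, ENNReal.ofReal (2 ^ r) *
        (I 1 1 (p' 0, spacePart p') + I 1 (-1) (p' 0, spacePart p')
          + I (-1) 1 (p' 0, spacePart p') + I (-1) (-1) (p' 0, spacePart p')) := by
        refine lintegral_mono_ae ?_
        filter_upwards [hae, hae'] with p' h h'
        refine (relativeKernel_rpow_le hr hm hp h.1 h'.1 h.2 h'.2).trans ?_
        gcongr
        rcases sign_eq_one_or_neg_one h.1 with e | e <;>
        rcases sign_eq_one_or_neg_one h'.1 with e' | e' <;> rw [e, e']
        · exact (le_self_add.trans le_self_add).trans le_self_add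
        · exact (le_add_self.trans le_self_add).trans le_self_add
        · exact le_add_self.trans le_self_add
        · exact le_add_self
    _ = ENNReal.ofReal (2 ^ r) * ∫⁻ z, (I 1 1 z + I 1 (-1) z + I (-1) 1 z + I (-1) (-1) z) := by
        rw [lintegral_const_mul' _ _ ENNReal.ofReal_ne_top,
          ← measurePreserving_time_space.lintegral_comp
            (f := fun z => I 1 1 z + I 1 (-1) z + I (-1) 1 z + I (-1) (-1) z)
            ((((hIm _ _).add (hIm _ _)).add (hIm _ _)).add (hIm _ _))]
    _ = ENNReal.ofReal (2 ^ r) * ((∫⁻ z, I 1 1 z) + (∫⁻ z, I 1 (-1) z) + (∫⁻ z, I (-1) 1 z)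
          + ∫⁻ z, I (-1) (-1) z) := by
        rw [lintegral_add_right _ (hIm _ _), lintegral_add_right _ (hIm _ _),
          lintegral_add_right _ (hIm _ _)]
    _ ≤ ENNReal.ofReal (2 ^ r) * (_ + _ + _ + _) :=
        mul_le_mul_right (add_le_add (add_le_add (add_le_add
          (hIle 1 1 (by norm_num) (by norm_num)) (hIle 1 (-1) (by norm_num) (by norm_num)))
          (hIle (-1) 1 (by norm_num) (by norm_num))) (hIle (-1) (-1) (by norm_num) (by norm_num))) _
    _ = _ := by rw [kernelConst]; ring

theorem enorm_weight_mul (s b : ℝ) (U : SpaceTime → ℂ) (p : SpaceTime) :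
    ‖(xWeight s b p : ℂ) * U p‖ₑ = ENNReal.ofReal (xWeight s b p) * ‖U p‖ₑ := by
  rw [enorm_mul, ← ofReal_norm, Complex.norm_real, Real.norm_of_nonneg
    (xWeight_nonneg s b p)]

theorem xNorm_eq_lintegral {r : ℝ} (hr : 1 < r) (s b : ℝ) (U : SpaceTime → ℂ) :
    xNorm r s b U = (∫⁻ p, (ENNReal.ofReal (xWeight s b p) * ‖U p‖ₑ) ^ (r / (r - 1)))
      ^ (1 / (r / (r - 1))) := by
  have hq : 0 < r / (r - 1) := div_pos (by linarith) (by linarith)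
  rw [xNorm, eLpNorm_eq_lintegral_rpow_enorm_toReal (by simpa using hq) ENNReal.ofReal_ne_top,
    ENNReal.toReal_ofReal hq.le]
  simp_rw [enorm_weight_mul]

theorem lintegral_convolution (f g : SpaceTime → ℝ≥0∞) (hf : AEMeasurable f) (hg : AEMeasurable g) :
    ∫⁻ p, ∫⁻ p', f p' * g (p - p') = (∫⁻ p, f p) * ∫⁻ p, g p := by
  have hg' : AEMeasurable (fun z : SpaceTime × SpaceTime => g (z.1 - z.2))
      (volume.prod volume) :=
    hg.comp_quasiMeasurePreserving (quasiMeasurePreserving_sub volume volume)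
  have hf' : AEMeasurable (fun z : SpaceTime × SpaceTime => f z.2) (volume.prod volume) :=
    hf.comp_quasiMeasurePreserving Measure.quasiMeasurePreserving_snd
  rw [lintegral_lintegral_swap (hf'.mul hg')]
  have : ∀ p', ∫⁻ p, f p' * g (p - p') = f p' * ∫⁻ p, g p := by
    intro p'
    have : AEMeasurable fun p => g (p - p') := hg.comp_quasiMeasurePreserving
      (measurePreserving_sub_right volume p').quasiMeasurePreserving
    rw [lintegral_const_mul'' _ this, lintegral_sub_right_eq_self g p']
  simp_rw [this]
  rw [lintegral_mul_const'' _ hf]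

/-- Hölder's inequality for the integral defining the bilinear form at `p`, with the kernel
estimate inserted. -/
theorem lintegral_bilinear_le {r b α₀ α₁ α₂ : ℝ} (hr : 1 < r) (hα₀ : 0 ≤ α₀)
    (hα₁ : 0 ≤ α₁) (hα₂ : 0 ≤ α₂) (hα₁' : α₁ ≤ 2 / r) (hα₂' : α₂ ≤ 2 / r)
    (hscale : α₁ + α₂ - α₀ = 2 / r) {m : SpaceTime → SpaceTime → ℂ} (hm : IsNullSymbol m)
    {U V : SpaceTime → ℂ} (hU : AEStronglyMeasurable U) (hV : AEStronglyMeasurable V)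
    {p : SpaceTime} (hp : spaceNorm p ≠ 0) :
    ENNReal.ofReal (spaceNorm p ^ α₀) * ∫⁻ p', ‖m p' (p - p') * U p' * V (p - p')‖ₑ
      ≤ kernelConst r b ^ (1 / r) *
        (∫⁻ p', (ENNReal.ofReal (xWeight α₁ b p') * ‖U p'‖ₑ) ^ (r / (r - 1)) *
          (ENNReal.ofReal (xWeight α₂ b (p - p')) * ‖V (p - p')‖ₑ) ^ (r / (r - 1)))
            ^ (1 / (r / (r - 1))) := by
  have hr0 : 0 < r := by linarith
  have hpos : 0 < spaceNorm p := (spaceNorm_nonneg p).lt_of_ne' hp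
  have hconj : r.HolderConjugate (r / (r - 1)) := Real.HolderConjugate.conjExponent hr
  have hq : 0 ≤ r / (r - 1) := hconj.symm.pos.le
  have hmp := (Measure.measurePreserving_sub_left (volume : Measure SpaceTime) p)
  set f : SpaceTime → ℝ≥0∞ := fun p' => ENNReal.ofReal (relativeKernel b α₁ α₂ m p p')
  set g : SpaceTime → ℝ≥0∞ := fun p' => (ENNReal.ofReal (xWeight α₁ b p') * ‖U p'‖ₑ) *
    (ENNReal.ofReal (xWeight α₂ b (p - p')) * ‖V (p - p')‖ₑ)
  have hf : AEMeasurable f := (measurable_relativeKernel hm p).ennreal_ofReal.aemeasurable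
  have hg : AEMeasurable g := by
    have h1 : AEMeasurable fun p' => ENNReal.ofReal (xWeight α₁ b p') * ‖U p'‖ₑ :=
      (measurable_xWeight α₁ b).ennreal_ofReal.aemeasurable.mul hU.enorm
    have h2 : AEMeasurable fun p' => ENNReal.ofReal (xWeight α₂ b p') * ‖V p'‖ₑ :=
      (measurable_xWeight α₂ b).ennreal_ofReal.aemeasurable.mul hV.enorm
    exact h1.mul (h2.comp_quasiMeasurePreserving hmp.quasiMeasurePreserving)
  have hae := ae_time_ne_zero_and_spaceNorm_ne_zero
  have hae' := hmp.quasiMeasurePreserving.ae hae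
  have hfg : ∫⁻ p', ‖m p' (p - p') * U p' * V (p - p')‖ₑ = ∫⁻ p', (f * g) p' := by
    refine lintegral_congr_ae ?_
    filter_upwards [hae, hae'] with p' h h'
    have w1 := xWeight_pos α₁ b h.2
    have w2 := xWeight_pos α₂ b h'.2
    simp only [Pi.mul_apply, f, g, relativeKernel]
    rw [enorm_mul, enorm_mul, ENNReal.ofReal_mul (norm_nonneg _), ofReal_norm,
      ENNReal.ofReal_mul (by positivity)]
    have c1 : ENNReal.ofReal (xWeight α₁ b p')⁻¹ * ENNReal.ofReal (xWeight α₁ b p') = 1 := by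
      rw [← ENNReal.ofReal_mul (by positivity), inv_mul_cancel₀ w1.ne', ENNReal.ofReal_one]
    have c2 : ENNReal.ofReal (xWeight α₂ b (p - p'))⁻¹ *
        ENNReal.ofReal (xWeight α₂ b (p - p')) = 1 := by
      rw [← ENNReal.ofReal_mul (by positivity), inv_mul_cancel₀ w2.ne', ENNReal.ofReal_one]
    calc _ = ‖m p' (p - p')‖ₑ * ‖U p'‖ₑ * ‖V (p - p')‖ₑ
          * (ENNReal.ofReal (xWeight α₁ b p')⁻¹ * ENNReal.ofReal (xWeight α₁ b p'))
          * (ENNReal.ofReal (xWeight α₂ b (p - p'))⁻¹ * ENNReal.ofReal (xWeight α₂ b (p - p'))) := by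
          rw [c1, c2, mul_one, mul_one]
      _ = _ := by ring
  rw [hfg]
  calc _ ≤ ENNReal.ofReal (spaceNorm p ^ α₀) * ((∫⁻ p', f p' ^ r) ^ (1 / r) *
        (∫⁻ p', g p' ^ (r / (r - 1))) ^ (1 / (r / (r - 1)))) :=
        mul_le_mul_right (ENNReal.lintegral_mul_le_Lp_mul_Lq volume hconj hf hg) _
    _ ≤ ENNReal.ofReal (spaceNorm p ^ α₀) *
        ((kernelConst r b * ENNReal.ofReal (spaceNorm p ^ (-(α₀ * r)))) ^ (1 / r) *
        (∫⁻ p', g p' ^ (r / (r - 1))) ^ (1 / (r / (r - 1)))) := by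
        refine mul_le_mul_right (mul_le_mul_left (ENNReal.rpow_le_rpow ?_ (by positivity)) _) _
        exact lintegral_relativeKernel_rpow_le hr hα₀ hα₁ hα₂ hα₁' hα₂' hscale hm hp
    _ = kernelConst r b ^ (1 / r) * (∫⁻ p', g p' ^ (r / (r - 1))) ^ (1 / (r / (r - 1))) := by
        have e1 : ENNReal.ofReal (spaceNorm p ^ (-(α₀ * r))) ^ (1 / r)
            = ENNReal.ofReal (spaceNorm p ^ (-α₀)) := by
          rw [ENNReal.ofReal_rpow_of_nonneg (by positivity) (by positivity),
            ← Real.rpow_mul hpos.le]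
          congr 2
          field_simp
        have e2 : ENNReal.ofReal (spaceNorm p ^ α₀) * ENNReal.ofReal (spaceNorm p ^ (-α₀)) = 1 := by
          rw [← ENNReal.ofReal_mul (by positivity), ← Real.rpow_add hpos, add_neg_cancel,
            Real.rpow_zero, ENNReal.ofReal_one]
        rw [ENNReal.mul_rpow_of_nonneg _ _ (by positivity : 0 ≤ 1 / r), e1]
        calc _ = kernelConst r b ^ (1 / r) * (ENNReal.ofReal (spaceNorm p ^ α₀) *
              ENNReal.ofReal (spaceNorm p ^ (-α₀))) *
              (∫⁻ p', g p' ^ (r / (r - 1))) ^ (1 / (r / (r - 1))) := by ring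
          _ = _ := by rw [e2, mul_one]
    _ = _ := by
        congr 2
        exact lintegral_congr fun p' => ENNReal.mul_rpow_of_nonneg _ _ hq

theorem ae_spaceNorm_ne_zero : ∀ᵐ p : SpaceTime, spaceNorm p ≠ 0 :=
  ae_time_ne_zero_and_spaceNorm_ne_zero.mono fun _ h => h.2

theorem aestronglyMeasurable_bilinear_integrand {m : SpaceTime → SpaceTime → ℂ}
    (hm : IsNullSymbol m) {U V : SpaceTime → ℂ} (hU : AEStronglyMeasurable U)
    (hV : AEStronglyMeasurable V) :
    AEStronglyMeasurable (fun z : SpaceTime × SpaceTime => m z.2 (z.1 - z.2) * U z.2 * V (z.1 - z.2))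
      (volume.prod volume) := by
  have h1 : Measurable fun z : SpaceTime × SpaceTime => m z.2 (z.1 - z.2) :=
    hm.measurable.comp (f := fun z : SpaceTime × SpaceTime => (z.2, z.1 - z.2)) (by fun_prop)
  exact (h1.aestronglyMeasurable.mul
    (hU.comp_quasiMeasurePreserving Measure.quasiMeasurePreserving_snd)).mul
    (hV.comp_quasiMeasurePreserving (quasiMeasurePreserving_sub volume volume))

theorem aemeasurable_weight_mul_enorm (s b : ℝ) {U : SpaceTime → ℂ}
    (hU : AEStronglyMeasurable U) (q : ℝ) :
    AEMeasurable fun p => (ENNReal.ofReal (xWeight s b p) * ‖U p‖ₑ) ^ q :=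
  ((measurable_xWeight s b).ennreal_ofReal.aemeasurable.mul hU.enorm).pow_const q

theorem xWeight_zero_right (s : ℝ) (p : SpaceTime) : xWeight s 0 p = spaceNorm p ^ s := by
  rw [xWeight, Real.rpow_zero, mul_one]

theorem xNorm_bilinearHat_le {r b α₀ α₁ α₂ : ℝ} (hr : 1 < r) (hα₀ : 0 ≤ α₀)
    (hα₁ : 0 ≤ α₁) (hα₂ : 0 ≤ α₂) (hα₁' : α₁ ≤ 2 / r) (hα₂' : α₂ ≤ 2 / r)
    (hscale : α₁ + α₂ - α₀ = 2 / r) {m : SpaceTime → SpaceTime → ℂ} (hm : IsNullSymbol m)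
    {U V : SpaceTime → ℂ} (hU : AEStronglyMeasurable U) (hV : AEStronglyMeasurable V) :
    xNorm r α₀ 0 (bilinearHat m U V)
      ≤ kernelConst r b ^ (1 / r) * xNorm r α₁ b U * xNorm r α₂ b V := by
  rw [xNorm_eq_lintegral hr, xNorm_eq_lintegral hr, xNorm_eq_lintegral hr]
  have hfm := aemeasurable_weight_mul_enorm α₁ b hU (r / (r - 1))
  have hgm := aemeasurable_weight_mul_enorm α₂ b hV (r / (r - 1))
  have hpt : ∀ p : SpaceTime, spaceNorm p ≠ 0 →
      ENNReal.ofReal (xWeight α₀ 0 p) * ‖bilinearHat m U V p‖ₑ ≤ _ := fun p hp =>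
    le_trans (mul_le_mul' (le_of_eq (by rw [xWeight_zero_right])) (enorm_integral_le_lintegral_enorm _))
      (lintegral_bilinear_le (b := b) hr hα₀ hα₁ hα₂ hα₁' hα₂' hscale hm hU hV hp)
  have hq : 0 < r / (r - 1) := div_pos (by linarith) (by linarith)
  generalize r / (r - 1) = q at *
  calc _ ≤ (∫⁻ p, (kernelConst r b ^ (1 / r) *
        (∫⁻ p', (ENNReal.ofReal (xWeight α₁ b p') * ‖U p'‖ₑ) ^ q *
          (ENNReal.ofReal (xWeight α₂ b (p - p')) * ‖V (p - p')‖ₑ) ^ q) ^ (1 / q)) ^ q)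
            ^ (1 / q) := by
        refine ENNReal.rpow_le_rpow (lintegral_mono_ae ?_) (by positivity)
        filter_upwards [ae_spaceNorm_ne_zero] with p hp
        exact ENNReal.rpow_le_rpow (hpt p hp) hq.le
    _ ≤ ((kernelConst r b ^ (1 / r)) ^ q *
          ((∫⁻ p, (ENNReal.ofReal (xWeight α₁ b p) * ‖U p‖ₑ) ^ q) *
          ∫⁻ p, (ENNReal.ofReal (xWeight α₂ b p) * ‖V p‖ₑ) ^ q)) ^ (1 / q) := by
        refine ENNReal.rpow_le_rpow (le_of_eq ?_) (by positivity)
        rw [← lintegral_convolution _ _ hfm hgm, ← lintegral_const_mul'']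
        · refine lintegral_congr fun p => ?_
          rw [ENNReal.mul_rpow_of_nonneg _ _ hq.le, ← ENNReal.rpow_mul (∫⁻ _, _),
            one_div_mul_cancel hq.ne', ENNReal.rpow_one]
        · have hg' := hgm.comp_quasiMeasurePreserving
            (quasiMeasurePreserving_sub (volume : Measure SpaceTime) volume)
          have hf' := hfm.comp_quasiMeasurePreserving
            (Measure.quasiMeasurePreserving_snd (μ := (volume : Measure SpaceTime)) (ν := volume))
          exact (hf'.mul hg').lintegral_prod_right'
    _ = _ := by
        rw [ENNReal.mul_rpow_of_nonneg _ _ (by positivity), ENNReal.mul_rpow_of_nonneg _ _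
          (by positivity), ← ENNReal.rpow_mul, mul_one_div_cancel hq.ne', ENNReal.rpow_one, mul_assoc]

theorem ae_integrable_bilinear {r b α₀ α₁ α₂ : ℝ} (hr : 1 < r) (hb : 1 < b * r) (hα₀ : 0 ≤ α₀)
    (hα₁ : 0 ≤ α₁) (hα₂ : 0 ≤ α₂) (hα₁' : α₁ ≤ 2 / r) (hα₂' : α₂ ≤ 2 / r)
    (hscale : α₁ + α₂ - α₀ = 2 / r) {m : SpaceTime → SpaceTime → ℂ} (hm : IsNullSymbol m)
    {U V : SpaceTime → ℂ} (hU : MemX r α₁ b U) (hV : MemX r α₂ b V) :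
    ∀ᵐ p : SpaceTime, Integrable (fun p' => m p' (p - p') * U p' * V (p - p')) := by
  obtain ⟨hU, hU'⟩ := hU
  obtain ⟨hV, hV'⟩ := hV
  rw [xNorm_eq_lintegral hr] at hU' hV'
  have hfm := aemeasurable_weight_mul_enorm α₁ b hU (r / (r - 1))
  have hgm := aemeasurable_weight_mul_enorm α₂ b hV (r / (r - 1))
  have hpt := fun p (hp : spaceNorm p ≠ 0) =>
    lintegral_bilinear_le (b := b) hr hα₀ hα₁ hα₂ hα₁' hα₂' hscale hm hU hV hp
  have hq : 0 < r / (r - 1) := div_pos (by linarith) (by linarith)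
  generalize r / (r - 1) = q at *
  rw [ENNReal.rpow_lt_top_iff_of_pos (by positivity)] at hU' hV'
  have hg' := hgm.comp_quasiMeasurePreserving
    (quasiMeasurePreserving_sub (volume : Measure SpaceTime) volume)
  have hf' := hfm.comp_quasiMeasurePreserving
    (Measure.quasiMeasurePreserving_snd (μ := (volume : Measure SpaceTime)) (ν := volume))
  have hfin := ae_lt_top' (hf'.mul hg').lintegral_prod_right' (by
    have := lintegral_convolution _ _ hfm hgm
    exact this.trans_ne (ENNReal.mul_lt_top hU' hV').ne)
  filter_upwards [ae_spaceNorm_ne_zero, hfin] with p hp hp'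
  refine ⟨?_, ?_⟩
  · have h1 : Measurable fun p' => m p' (p - p') :=
      hm.measurable.comp (f := fun p' : SpaceTime => (p', p - p')) (by fun_prop)
    exact (h1.aestronglyMeasurable.mul hU).mul (hV.comp_quasiMeasurePreserving
      (Measure.measurePreserving_sub_left volume p).quasiMeasurePreserving)
  · have hlt := (hpt p hp).trans_lt (ENNReal.mul_lt_top
      (ENNReal.rpow_lt_top_of_nonneg (by positivity) (kernelConst_lt_top hb).ne)
      (ENNReal.rpow_lt_top_of_nonneg (by positivity) hp'.ne))
    have hpos : 0 < spaceNorm p := (spaceNorm_nonneg p).lt_of_ne' hp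
    refine ENNReal.lt_top_of_mul_ne_top_right hlt.ne ?_
    exact (ENNReal.ofReal_pos.mpr (Real.rpow_pos_of_pos hpos α₀)).ne'

theorem memX_bilinearHat {r b α₀ α₁ α₂ : ℝ} (hr : 1 < r) (hb : 1 < b * r) (hα₀ : 0 ≤ α₀)
    (hα₁ : 0 ≤ α₁) (hα₂ : 0 ≤ α₂) (hα₁' : α₁ ≤ 2 / r) (hα₂' : α₂ ≤ 2 / r)
    (hscale : α₁ + α₂ - α₀ = 2 / r) {m : SpaceTime → SpaceTime → ℂ} (hm : IsNullSymbol m)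
    {U V : SpaceTime → ℂ} (hU : MemX r α₁ b U) (hV : MemX r α₂ b V) :
    MemX r α₀ 0 (bilinearHat m U V) := by
  refine ⟨(aestronglyMeasurable_bilinear_integrand hm hU.1 hV.1).integral_prod_right', ?_⟩
  refine (xNorm_bilinearHat_le (b := b) hr hα₀ hα₁ hα₂ hα₁' hα₂' hscale hm hU.1 hV.1).trans_lt ?_
  exact ENNReal.mul_lt_top (ENNReal.mul_lt_top (ENNReal.rpow_lt_top_of_nonneg
    (by positivity) (kernelConst_lt_top hb).ne) hU.2) hV.2

/-! ### The null forms of Schwartz functions -/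

theorem abs_apply_succ_le_spaceNorm (p : SpaceTime) (j : Fin 3) : |p j.succ| ≤ spaceNorm p := by
  rw [← Real.sqrt_sq_eq_abs]
  exact Real.sqrt_le_sqrt (Finset.single_le_sum (f := fun j : Fin 3 => p j.succ ^ 2)
    (fun _ _ => sq_nonneg _) (Finset.mem_univ j))

theorem norm_spaceSymbol_le_one (j : Fin 3) (p : SpaceTime) : ‖spaceSymbol j p‖ ≤ 1 := by
  rw [spaceSymbol, norm_mul, Complex.norm_I, one_mul, Complex.norm_real, Real.norm_eq_abs, abs_div,
    abs_of_nonneg (spaceNorm_nonneg p)]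
  exact div_le_one_of_le₀ (abs_apply_succ_le_spaceNorm p j) (spaceNorm_nonneg p)

theorem norm_timeSymbol_le_one (p : SpaceTime) : ‖timeSymbol p‖ ≤ 1 := by
  rw [timeSymbol, norm_mul, Complex.norm_I, one_mul, Complex.norm_real, Real.norm_eq_abs]
  rcases Real.sign_apply_eq (p 0) with h | h | h <;> rw [h] <;> norm_num

theorem integrable_mul_schwartz {a : SpaceTime → ℂ} (ha : Measurable a) (h1 : ∀ p, ‖a p‖ ≤ 1)
    (ψ : 𝓢(SpaceTime, ℂ)) : Integrable (fun p => a p * ψ p) :=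
  ψ.integrable.bdd_mul ha.aestronglyMeasurable (Filter.Eventually.of_forall h1)

theorem memLp_two_mul_schwartz {a : SpaceTime → ℂ} (ha : Measurable a) (h1 : ∀ p, ‖a p‖ ≤ 1)
    (ψ : 𝓢(SpaceTime, ℂ)) : MemLp (fun p => a p * ψ p) 2 := by
  refine (ψ.memLp 2).of_le (ha.aestronglyMeasurable.mul ψ.continuous.aestronglyMeasurable) ?_
  filter_upwards with p
  rw [Pi.mul_apply, norm_mul]
  exact mul_le_of_le_one_left (norm_nonneg _) (h1 p)

theorem integrable_inv_norm_mul_one_add_norm :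
    Integrable (fun η : EuclideanSpace ℝ (Fin 3) => ‖η‖⁻¹ * (1 + ‖η‖) ^ (-4 : ℝ)) := by
  rw [integrable_fun_norm_addHaar volume (f := fun y : ℝ => y⁻¹ * (1 + y) ^ (-4 : ℝ))]
  have h := (integrable_one_add_norm (E := ℝ) (μ := volume) (r := 3) (by norm_num)).integrableOn
    (s := Set.Ioi 0)
  refine h.mono' (by fun_prop) ?_
  filter_upwards [self_mem_ae_restrict measurableSet_Ioi] with y hy
  have hy' : 0 < y := hy
  rw [finrank_euclideanSpace_fin, Real.norm_of_nonneg hy'.le, smul_eq_mul,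
    Real.norm_of_nonneg (by positivity)]
  calc y ^ (3 - 1) * (y⁻¹ * (1 + y) ^ (-4 : ℝ)) = y * (1 + y) ^ (-4 : ℝ) := by
        norm_num; field_simp
    _ ≤ (1 + y) * (1 + y) ^ (-4 : ℝ) := by gcongr; linarith
    _ = (1 + y) ^ (-3 : ℝ) := by
        rw [show (-3 : ℝ) = 1 + -4 by norm_num, Real.rpow_add (by positivity), Real.rpow_one]

theorem norm_spacePart_le (p : SpaceTime) : ‖spacePart p‖ ≤ ‖p‖ := by
  rw [← spaceNorm_eq_norm, spaceNorm, EuclideanSpace.norm_eq]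
  apply Real.sqrt_le_sqrt
  rw [Fin.sum_univ_succ (n := 3)]
  simp only [Real.norm_eq_abs, sq_abs]
  linarith [sq_nonneg (p 0)]

/-- The singularity `|ξ|⁻¹` of the symbol of `D⁻¹` is integrable in three space dimensions. -/
theorem integrable_one_add_norm_mul_inv_spaceNorm_mul (ψ : 𝓢(SpaceTime, ℂ)) :
    Integrable (fun p => (1 + ‖p‖) * ((spaceNorm p)⁻¹ * ‖ψ p‖)) := by
  obtain ⟨C, hC⟩ : ∃ C : ℝ, ∀ p, (1 + ‖p‖) ^ 7 * ‖ψ p‖ ≤ C :=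
    ⟨_, fun p => by
      simpa using SchwartzMap.one_add_le_sup_seminorm_apply (𝕜 := ℝ) (m := (7, 0)) (le_refl 7)
        (le_refl 0) ψ p⟩
  have h1 := integrable_one_add_norm (E := ℝ) (μ := volume) (r := 2) (by norm_num)
  have h2 := ((h1.mul_prod integrable_inv_norm_mul_one_add_norm).const_mul C)
  have h3 := (measurePreserving_time_space.integrable_comp h2.aestronglyMeasurable).mpr h2
  have hm := measurable_spaceNorm
  refine h3.mono' ?_ (Filter.Eventually.of_forall fun p => ?_)
  · have := ψ.continuous.measurable
    exact Measurable.aestronglyMeasurable (by fun_prop)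
  have hs := spaceNorm_nonneg p
  rw [Real.norm_of_nonneg (by positivity)]
  simp only [Function.comp_apply, ← spaceNorm_eq_norm]
  have hle : spaceNorm p ≤ ‖p‖ := by rw [spaceNorm_eq_norm]; exact norm_spacePart_le p
  have ht : ‖p 0‖ ≤ ‖p‖ := PiLp.norm_apply_le p 0
  have e1 : (1 + ‖p 0‖) ^ (-2 : ℝ) = ((1 + ‖p 0‖) ^ 2)⁻¹ := by
    rw [Real.rpow_neg (by positivity)]; norm_cast
  have e2 : (1 + spaceNorm p) ^ (-4 : ℝ) = ((1 + spaceNorm p) ^ 4)⁻¹ := by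
    rw [Real.rpow_neg (by positivity)]; norm_cast
  rw [e1, e2]
  have key : (1 + ‖p‖) * ‖ψ p‖ ≤ C * (((1 + ‖p 0‖) ^ 2)⁻¹ * ((1 + spaceNorm p) ^ 4)⁻¹) := by
    rw [← mul_inv, ← div_eq_mul_inv, le_div_iff₀ (by positivity)]
    calc (1 + ‖p‖) * ‖ψ p‖ * ((1 + ‖p 0‖) ^ 2 * (1 + spaceNorm p) ^ 4)
        ≤ (1 + ‖p‖) * ‖ψ p‖ * ((1 + ‖p‖) ^ 2 * (1 + ‖p‖) ^ 4) := by gcongr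
      _ = (1 + ‖p‖) ^ 7 * ‖ψ p‖ := by ring
      _ ≤ C := hC p
  calc _ = (spaceNorm p)⁻¹ * ((1 + ‖p‖) * ‖ψ p‖) := by ring
    _ ≤ (spaceNorm p)⁻¹ * (C * (((1 + ‖p 0‖) ^ 2)⁻¹ * ((1 + spaceNorm p) ^ 4)⁻¹)) := by gcongr
    _ = _ := by ring

/-- Differentiation under the integral sign; at `ξ = 0` both sides have the symbol `0`, since
`0⁻¹ = 0`. -/
theorem spaceDeriv_invD (j : Fin 3) (u : 𝓢(SpaceTime, ℂ)) :
    spaceDeriv j (invD u) = 𝓕⁻ (fun p => spaceSymbol j p * 𝓕 (u : SpaceTime → ℂ) p) := by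
  set ψ : 𝓢(SpaceTime, ℂ) := 𝓕 u with hψ
  have hψe : 𝓕 (u : SpaceTime → ℂ) = ψ := (SchwartzMap.fourier_coe u).symm
  set g : SpaceTime → ℂ := fun p => ((2 * Real.pi * spaceNorm p : ℝ) : ℂ)⁻¹ * ψ p with hg
  have hgn : ∀ p, ‖g p‖ = (2 * Real.pi)⁻¹ * ((spaceNorm p)⁻¹ * ‖ψ p‖) := by
    intro p
    rw [hg]
    simp only
    rw [norm_mul, norm_inv, Complex.norm_real, Real.norm_of_nonneg
      (mul_nonneg (by positivity) (spaceNorm_nonneg p)), mul_inv, mul_assoc]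
  have hgm : AEStronglyMeasurable g := by
    have h1 := measurable_spaceNorm
    have h2 := ψ.continuous.measurable
    exact Measurable.aestronglyMeasurable (by fun_prop)
  have hdom := (integrable_one_add_norm_mul_inv_spaceNorm_mul ψ).const_mul (2 * Real.pi)⁻¹
  have hnn : ∀ p, 0 ≤ (2 * Real.pi)⁻¹ * ((spaceNorm p)⁻¹ * ‖ψ p‖) := fun p => by
    have := spaceNorm_nonneg p
    positivity
  have hg1 : Integrable g := hdom.mono' hgm (Filter.Eventually.of_forall fun p => by
    rw [hgn]
    nlinarith [hnn p, norm_nonneg p, mul_nonneg (norm_nonneg p) (hnn p)])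
  have hg2 : Integrable (fun p => ‖p‖ * ‖g p‖) := by
    refine hdom.mono' (continuous_norm.aestronglyMeasurable.mul hgm.norm)
      (Filter.Eventually.of_forall fun p => ?_)
    rw [Real.norm_of_nonneg (by positivity), hgn]
    nlinarith [hnn p]
  have hinv : invD u = fun x => 𝓕 g (-x) := by
    ext x
    rw [← Real.fourierInv_eq_fourier_neg, invD, hψe]
  ext x
  have hd : HasFDerivAt (fun x => 𝓕 g (-x))
      ((𝓕 (VectorFourier.fourierSMulRight (innerSL ℝ) g) (-x)).comp
        (-ContinuousLinearMap.id ℝ SpaceTime)) x :=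
    (Real.hasFDerivAt_fourier hg1 hg2 (-x)).comp x (hasFDerivAt_id x).neg
  have hint : Integrable (fun p => VectorFourier.fourierSMulRight (innerSL ℝ) g p) := by
    refine (hg2.const_mul (2 * Real.pi * ‖innerSL ℝ (E := SpaceTime)‖)).mono'
      hgm.fourierSMulRight (Filter.Eventually.of_forall fun p => ?_)
    rw [← mul_assoc]
    exact VectorFourier.norm_fourierSMulRight_le _ _ _
  rw [spaceDeriv, hinv, hd.fderiv, Real.fourierInv_eq_fourier_neg, hψe]
  simp only [ContinuousLinearMap.comp_apply, neg_apply,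
    ContinuousLinearMap.id_apply, map_neg]
  rw [Real.fourier_continuousLinearMap_apply hint, Real.fourier_eq, Real.fourier_eq, ← integral_neg]
  refine integral_congr_ae (Filter.Eventually.of_forall fun p => ?_)
  have hin : innerSL ℝ p (EuclideanSpace.single j.succ (1 : ℝ)) = p j.succ := by
    refine (EuclideanSpace.inner_single_right j.succ 1 p).trans ?_
    simp
  simp only [VectorFourier.fourierSMulRight_apply, hg, spaceSymbol, hin, Circle.smul_def,
    smul_eq_mul, Complex.real_smul]
  have hpi : (Real.pi : ℂ) ≠ 0 := by exact_mod_cast Real.pi_ne_zero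
  push_cast
  simp only [mul_inv]
  field_simp

theorem timeDerivInvD_eq (u : 𝓢(SpaceTime, ℂ)) :
    timeDerivInvD u = 𝓕⁻ (fun p => timeSymbol p * 𝓕 (u : SpaceTime → ℂ) p) := by
  set ψ : 𝓢(SpaceTime, ℂ) := 𝓕 u with hψ
  have hψe : 𝓕 (u : SpaceTime → ℂ) = ψ := (SchwartzMap.fourier_coe u).symm
  have hpos : MeasurableSet {p : SpaceTime | 0 < p 0} :=
    measurableSet_lt measurable_const (by fun_prop)
  have hneg : MeasurableSet {p : SpaceTime | p 0 < 0} :=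
    measurableSet_lt (by fun_prop) measurable_const
  ext x
  rw [timeDerivInvD, plusPart, minusPart, hψe, Real.fourierInv_eq, Real.fourierInv_eq,
    Real.fourierInv_eq, ← integral_sub, ← integral_const_mul]
  · refine integral_congr_ae (Filter.Eventually.of_forall fun p => ?_)
    simp only [Circle.smul_def, smul_eq_mul, timeSymbol]
    rcases lt_trichotomy (p 0) 0 with h | h | h
    · rw [Real.sign_of_neg h, Set.indicator_of_notMem (by simpa using h.le),
        Set.indicator_of_mem (by simpa using h)]
      push_cast; ring
    · rw [h, Set.indicator_of_notMem (by simp [h]), Set.indicator_of_notMem (by simp [h])]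
      simp
    · rw [Real.sign_of_pos h, Set.indicator_of_mem (by simpa using h),
        Set.indicator_of_notMem (by simpa using h.le)]
      push_cast; ring
  · simpa using (Real.fourierIntegral_convergent_iff (-x)).mpr (ψ.integrable.indicator hpos)
  · simpa using (Real.fourierIntegral_convergent_iff (-x)).mpr (ψ.integrable.indicator hneg)

/-- A linear combination of products of bounded multipliers applied to Schwartz functions is
integrable, and its Fourier transform is given by its symbol. -/
theorem fourier_sum_mul {ι : Type*} [Fintype ι] (ε : ι → ℂ) (a c : ι → SpaceTime → ℂ)
    (ha : ∀ k, Measurable (a k)) (hc : ∀ k, Measurable (c k)) (ha' : ∀ k p, ‖a k p‖ ≤ 1)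
    (hc' : ∀ k p, ‖c k p‖ ≤ 1) (u v : 𝓢(SpaceTime, ℂ)) :
    Integrable (fun x => ∑ k, ε k * (𝓕⁻ (fun p => a k p * 𝓕 (u : SpaceTime → ℂ) p) x *
        𝓕⁻ (fun p => c k p * 𝓕 (v : SpaceTime → ℂ) p) x)) ∧
      𝓕 (fun x => ∑ k, ε k * (𝓕⁻ (fun p => a k p * 𝓕 (u : SpaceTime → ℂ) p) x *
        𝓕⁻ (fun p => c k p * 𝓕 (v : SpaceTime → ℂ) p) x))
        = bilinearHat (fun p p' => ∑ k, ε k * (a k p * c k p')) (𝓕 (u : SpaceTime → ℂ))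
          (𝓕 (v : SpaceTime → ℂ)) := by
  have hu : 𝓕 (u : SpaceTime → ℂ) = (𝓕 u : 𝓢(SpaceTime, ℂ)) := (SchwartzMap.fourier_coe u).symm
  have hv : 𝓕 (v : SpaceTime → ℂ) = (𝓕 v : 𝓢(SpaceTime, ℂ)) := (SchwartzMap.fourier_coe v).symm
  rw [hu, hv]
  generalize (𝓕 u : 𝓢(SpaceTime, ℂ)) = φ
  generalize (𝓕 v : 𝓢(SpaceTime, ℂ)) = ψ
  have A1 := fun k => integrable_mul_schwartz (ha k) (ha' k) φ
  have A2 := fun k => memLp_two_mul_schwartz (ha k) (ha' k) φ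
  have C1 := fun k => integrable_mul_schwartz (hc k) (hc' k) ψ
  have C2 := fun k => memLp_two_mul_schwartz (hc k) (hc' k) ψ
  have hint := fun k => integrable_fourierInv_mul (A1 k) (A2 k) (C1 k) (C2 k)
  refine ⟨integrable_finsetSum _ fun k _ => (hint k).const_mul (ε k), ?_⟩
  ext p
  calc _ = ∑ k, ε k * 𝓕 (fun x => 𝓕⁻ (fun p => a k p * φ p) x * 𝓕⁻ (fun p => c k p * ψ p) x) p := by
        simp only [Real.fourier_eq, ← integral_const_mul]
        rw [← integral_finsetSum]
        · refine integral_congr_ae (Filter.Eventually.of_forall fun x => ?_)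
          simp only [Circle.smul_def, smul_eq_mul, Finset.mul_sum]
          exact Finset.sum_congr rfl fun k _ => by ring
        · exact fun k _ => ((Real.fourierIntegral_convergent_iff p).mpr (hint k)).const_mul (ε k)
    _ = ∑ k, ε k * ∫ p', (a k p' * φ p') * (c k (p - p') * ψ (p - p')) :=
        Finset.sum_congr rfl fun k _ => by
          rw [fourier_fourierInv_mul (A1 k) (A2 k) (C1 k) (C2 k)]
    _ = _ := by
        simp only [← integral_const_mul]
        rw [← integral_finsetSum]
        · refine integral_congr_ae (Filter.Eventually.of_forall fun p' => ?_)
          simp only [Finset.sum_mul]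
          exact Finset.sum_congr rfl fun k _ => by ring
        · exact fun k _ => (integrable_mul_comp_sub (A2 k) (C2 k) p).const_mul (ε k)

theorem fourier_qSpace (i j : Fin 3) (u v : 𝓢(SpaceTime, ℂ)) :
    Integrable (qSpace i j u v) ∧ 𝓕 (qSpace i j u v)
      = bilinearHat (qSpaceSymbol i j) (𝓕 (u : SpaceTime → ℂ)) (𝓕 (v : SpaceTime → ℂ)) := by
  convert! fourier_sum_mul ![1, -1] ![spaceSymbol i, spaceSymbol j] ![spaceSymbol j, spaceSymbol i]
    (by simp [Fin.forall_fin_two, measurable_spaceSymbol])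
    (by simp [Fin.forall_fin_two, measurable_spaceSymbol])
    (by simp [Fin.forall_fin_two, norm_spaceSymbol_le_one])
    (by simp [Fin.forall_fin_two, norm_spaceSymbol_le_one]) u v using 2
  · ext x; simp [qSpace, spaceDeriv_invD, sub_eq_add_neg]
  · congr 1; ext x; simp [qSpace, spaceDeriv_invD, sub_eq_add_neg]
  · congr 1; ext p p'; simp [qSpaceSymbol, sub_eq_add_neg]

theorem fourier_qTime (j : Fin 3) (u v : 𝓢(SpaceTime, ℂ)) :
    Integrable (qTime j u v) ∧ 𝓕 (qTime j u v)
      = bilinearHat (qTimeSymbol j) (𝓕 (u : SpaceTime → ℂ)) (𝓕 (v : SpaceTime → ℂ)) := by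
  convert! fourier_sum_mul ![1, -1] ![timeSymbol, spaceSymbol j] ![spaceSymbol j, timeSymbol]
    (by simp [Fin.forall_fin_two, measurable_spaceSymbol, measurable_timeSymbol])
    (by simp [Fin.forall_fin_two, measurable_spaceSymbol, measurable_timeSymbol])
    (by simp [Fin.forall_fin_two, norm_spaceSymbol_le_one, norm_timeSymbol_le_one])
    (by simp [Fin.forall_fin_two, norm_spaceSymbol_le_one, norm_timeSymbol_le_one]) u v using 2
  · ext x; simp [qTime, spaceDeriv_invD, timeDerivInvD_eq, sub_eq_add_neg]
  · congr 1; ext x; simp [qTime, spaceDeriv_invD, timeDerivInvD_eq, sub_eq_add_neg]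
  · congr 1; ext p p'; simp [qTimeSymbol, sub_eq_add_neg]

theorem fourier_qZero (u v : 𝓢(SpaceTime, ℂ)) :
    Integrable (qZero u v) ∧ 𝓕 (qZero u v)
      = bilinearHat qZeroSymbol (𝓕 (u : SpaceTime → ℂ)) (𝓕 (v : SpaceTime → ℂ)) := by
  have key := fourier_sum_mul (Fin.cons 1 fun _ : Fin 3 => -1 : Fin 4 → ℂ)
    (Fin.cons timeSymbol spaceSymbol : Fin 4 → SpaceTime → ℂ)
    (Fin.cons timeSymbol spaceSymbol : Fin 4 → SpaceTime → ℂ)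
    (by simp [Fin.forall_fin_succ, measurable_spaceSymbol, measurable_timeSymbol])
    (by simp [Fin.forall_fin_succ, measurable_spaceSymbol, measurable_timeSymbol])
    (Fin.cases norm_timeSymbol_le_one norm_spaceSymbol_le_one)
    (Fin.cases norm_timeSymbol_le_one norm_spaceSymbol_le_one) u v
  simp only [Fin.sum_univ_succ (n := 3), Fin.cons_zero, Fin.cons_succ] at key
  convert! key using 2
  · ext x; simp [qZero, spaceDeriv_invD, timeDerivInvD_eq, sub_eq_add_neg]
  · congr 1; ext x; simp [qZero, spaceDeriv_invD, timeDerivInvD_eq, sub_eq_add_neg]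
  · congr 1; ext p p'; simp [qZeroSymbol, sub_eq_add_neg]

/-! ### The null form estimates -/

theorem nullFormEstimate_of_isNullSymbol {r b α₀ α₁ α₂ : ℝ} (hr : 1 < r) (hb : 1 < b * r)
    (hα₀ : 0 ≤ α₀) (hα₁ : 0 ≤ α₁) (hα₂ : 0 ≤ α₂) (hα₁' : α₁ ≤ 2 / r) (hα₂' : α₂ ≤ 2 / r)
    (hscale : α₁ + α₂ - α₀ = 2 / r) {m : SpaceTime → SpaceTime → ℂ} (hm : IsNullSymbol m)
    {q : (SpaceTime → ℂ) → (SpaceTime → ℂ) → SpaceTime → ℂ}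
    (hq : ∀ u v : 𝓢(SpaceTime, ℂ), Integrable (q u v) ∧
      𝓕 (q u v) = bilinearHat m (𝓕 (u : SpaceTime → ℂ)) (𝓕 (v : SpaceTime → ℂ))) :
    NullFormEstimate r b α₀ α₁ α₂ (kernelConst r b ^ (1 / r)).toNNReal q m := by
  have hC : ((kernelConst r b ^ (1 / r)).toNNReal : ℝ≥0∞) = kernelConst r b ^ (1 / r) :=
    ENNReal.coe_toNNReal
      (ENNReal.rpow_lt_top_of_nonneg (by positivity) (kernelConst_lt_top hb).ne).ne
  have hfm : ∀ u : 𝓢(SpaceTime, ℂ),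
      AEStronglyMeasurable (𝓕 (u : SpaceTime → ℂ)) volume := fun u =>
    (𝓕 u : 𝓢(SpaceTime, ℂ)).continuous.aestronglyMeasurable
  refine ⟨fun u v => (hq u v).1, fun u v => (hq u v).2, fun u v => ?_, fun U V hU hV => ?_,
    fun U V hU hV => ?_, fun U V hU hV => ?_⟩
  · rw [(hq u v).2, hC]
    exact xNorm_bilinearHat_le hr hα₀ hα₁ hα₂ hα₁' hα₂' hscale hm (hfm u) (hfm v)
  · exact ae_integrable_bilinear hr hb hα₀ hα₁ hα₂ hα₁' hα₂' hscale hm hU hV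
  · exact memX_bilinearHat hr hb hα₀ hα₁ hα₂ hα₁' hα₂' hscale hm hU hV
  · rw [hC]
    exact xNorm_bilinearHat_le hr hα₀ hα₁ hα₂ hα₁' hα₂' hscale hm hU.1 hV.1

theorem lemma2p1 (r b α₀ α₁ α₂ : ℝ) (hr : 1 < r) (hr2 : r ≤ 2) (hb : 1 / r < b)
    (hα₀ : 0 ≤ α₀) (hα₁ : 0 ≤ α₁) (hα₂ : 0 ≤ α₂)
    (hα₁' : α₁ ≤ 2 / r) (hα₂' : α₂ ≤ 2 / r) (hscale : α₁ + α₂ - α₀ = 2 / r) :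
    (3 / r - 1 < α₁ + α₂ → α₁ ≠ 2 / r - 1 / 2 → α₂ ≠ 2 / r - 1 / 2 →
      (∃ C : ℝ≥0, ∀ i j : Fin 3,
        NullFormEstimate r b α₀ α₁ α₂ C (qSpace i j) (qSpaceSymbol i j)) ∧
      (∃ C : ℝ≥0, ∀ j : Fin 3,
        NullFormEstimate r b α₀ α₁ α₂ C (qTime j) (qTimeSymbol j))) ∧
    (3 / r - 2 ≤ α₁ + α₂ → α₁ ≠ 2 / r - 1 → α₂ ≠ 2 / r - 1 →
      ∃ C : ℝ≥0, NullFormEstimate r b α₀ α₁ α₂ C qZero qZeroSymbol) := by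

  have hbr : 1 < b * r := (div_lt_iff₀ (by linarith)).mp hb
  exact ⟨fun _ _ _ =>
    ⟨⟨_, fun i j => nullFormEstimate_of_isNullSymbol hr hbr hα₀ hα₁ hα₂ hα₁' hα₂' hscale
      (isNullSymbol_qSpaceSymbol i j) (fourier_qSpace i j)⟩,
    ⟨_, fun j => nullFormEstimate_of_isNullSymbol hr hbr hα₀ hα₁ hα₂ hα₁' hα₂' hscale
      (isNullSymbol_qTimeSymbol j) (fourier_qTime j)⟩⟩,
    fun _ _ _ => ⟨_, nullFormEstimate_of_isNullSymbol hr hbr hα₀ hα₁ hα₂ hα₁' hα₂' hscale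
      isNullSymbol_qZeroSymbol fourier_qZero⟩⟩
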